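/- Let $\Omega$ be an arbitrary index set and let $B=\mathbb{R}\left[X_i,\tfrac{1}{1+X_i^2}: i\in\Omega\right]$ be the localization of the polynomial algebra $\mathbb{R}[X_i:i\in\Omega]$ at the multiplicative set generated by the elements $1+X_i^2$, $i\in\Omega$. For a unital commutative real algebra $A$, let $X(A)$ be the set of all unital $\mathbb{R}$-algebra homomorphisms $\alpha:A\to\mathbb{R}$, endowed with the weakest topology making all evaluations $\hat a:\alpha\mapsto\alpha(a)$, $a\in A$, continuous. Let $I$ be the set of all finitely generated (unital) subalgebras $S$ of $B$, let $\pi_S:X(B)\to X(S)$, $\alpha\mapsto\alpha|_S$, and let $\Sigma_I$ be the cylinder $\sigma$-algebra on $X(B)$, i.e. the smallest $\sigma$-algebra for which all $\pi_S$, $S\in I$, are measurable, where $X(S)$ carries its Borel $\sigma$-algebra. A quadratic module in $A$ is a subset $Q\subseteq A$ with $1\in Q$, $Q+Q\subseteq Q$ and $a^2Q\subseteq Q$ for all $a\in A$; it is countably generated if it is the smallest quadratic module containing some countable set. Put $K_Q:=\{\alpha\in X(A):\alpha(a)\ge 0 \text{ for all } a\in Q\}$; for a quadratic module $Q$ in $B$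 and $S\in I$ the set $Q\cap S$ is a quadratic module in $S$, and $K_{Q\cap S}\subseteq X(S)$ is defined accordingly. A measure $\mu$ on a $\sigma$-algebra $\Sigma$ on $X(B)$ is supported in $K\in\Sigma$ if $\mu(X(B)\setminus K)=0$; it is $K$-representing for a linear functional $L:B\to\mathbb{R}$ if it is supported in $K\in\Sigma$ and, for all $b\in B$, $\hat b$ is $\mu$-integrable with $L(b)=\int_{X(B)}\hat b\,d\mu$. A Radon measure is a locally finite Borel measure $\nu$ with $\nu(M)=\sup\{\nu(C):C\subseteq M\text{ compact}\}$ for all Borel sets $M$. **Theorem.** Let $L:B\to\mathbb{R}$ be linear with $L(1)=1$ and let $Q$ be a quadratic module in $B$ with $L(Q)\subseteq[0,\infty)$. Then: (i) There exists a unique $X(B)$-representing measure $\mu$ for $L$ on $\Sigma_I$ that is supported in $\pi_S^{-1}(K_{Q\cap S})$ for every $S\in I$. Moreover, if $Q$ is countably generated, then $K_Q\in\Sigma_I$ and $\mu$ is a $K_Q$-representing measure for $L$ on $\Sigma_I$. (ii) With $\mu$ as in (i), there exists a unique $K_Q$-representing Radon measure $\nu$ for $L$ on the Borel $\sigma$-algebra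 of $X(B)$ if and only if the family of pushforwards $\{{\pi_S}_{\#}\mu : S\in I\}$ fulfills Prokhorov's condition: for every $\varepsilon>0$ there exists a compact set $C_\varepsilon\subseteq X(B)$ such that ${\pi_S}_{\#}\mu(\pi_S(C_\varepsilon))\ge 1-\varepsilon$ for all $S\in I$. -/

import Mathlib

open MeasureTheory

noncomputable section

namespace CharMoment

/-- The character space `X(A)` of a unital commutative real algebra: all unital `ℝ`-algebra
homomorphisms `A → ℝ`. -/
def CharSpace (A : Type*) [CommRing A] [Algebra ℝ A] : Type _ := A →ₐ[ℝ] ℝ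

variable {A : Type*} [CommRing A] [Algebra ℝ A]

instance : FunLike (CharSpace A) A ℝ := inferInstanceAs (FunLike (A →ₐ[ℝ] ℝ) A ℝ)

/-- The weakest topology on `X(A)` making every evaluation `α ↦ α a` continuous. -/
instance : TopologicalSpace (CharSpace A) :=
  TopologicalSpace.induced (fun (α : CharSpace A) (a : A) => α a) Pi.topologicalSpace

/-- The default σ-algebra on `X(A)` is the Borel σ-algebra. -/
instance : MeasurableSpace (CharSpace A) := borel (CharSpace A)

instance : BorelSpace (CharSpace A) := ⟨rfl⟩

/-- The restriction map `π_S : X(A) → X(S)` for a subalgebra `S` of `A`. -/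
def res (S : Subalgebra ℝ A) (α : CharSpace A) : CharSpace S := AlgHom.comp α S.val

theorem res_apply (S : Subalgebra ℝ A) (α : CharSpace A) (a : S) : res S α a = α (a : A) := rfl

variable (A) in
/-- The cylinder σ-algebra on `X(A)`: the smallest σ-algebra for which all the maps
`π_S : X(A) → X(S)`, `S` a finitely generated subalgebra, are measurable, each `X(S)` carrying
its Borel σ-algebra. -/
@[reducible] def cylinder : MeasurableSpace (CharSpace A) :=
  ⨆ S : {S : Subalgebra ℝ A // S.FG}, MeasurableSpace.comap (res S.1) inferInstance

/-- The restriction maps to finitely generated subalgebras are measurable for the cylinder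
σ-algebra, so that pushforwards along them are meaningful. -/
theorem measurable_res {S : Subalgebra ℝ A} (hS : S.FG) :
    @Measurable _ _ (cylinder A) _ (res S) :=
  Measurable.of_comap_le
    (le_iSup (fun S : {S : Subalgebra ℝ A // S.FG} =>
      MeasurableSpace.comap (res S.1) inferInstance) ⟨S, hS⟩)

variable (A) in
/-- A quadratic module of `A`: a subset containing `1`, closed under addition and under
multiplication by squares. -/
structure QuadraticModule where
  /-- the underlying set -/
  carrier : Set A
  one_mem : 1 ∈ carrier
  add_mem : ∀ {a b : A}, a ∈ carrier → b ∈ carrier → a + b ∈ carrier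
  sq_mul_mem : ∀ (a : A) {b : A}, b ∈ carrier → a ^ 2 * b ∈ carrier

namespace QuadraticModule

/-- The quadratic module `Q ∩ S` of a subalgebra `S`. -/
def inter (Q : QuadraticModule A) (S : Subalgebra ℝ A) : QuadraticModule S where
  carrier := {a : S | (a : A) ∈ Q.carrier}
  one_mem := Q.one_mem
  add_mem := fun ha hb => Q.add_mem ha hb
  sq_mul_mem := fun a _ hb => Q.sq_mul_mem (a : A) hb

/-- `Q` is generated by a countable set `G`, i.e. it is the smallest quadratic module
containing `G`. -/
def CountablyGenerated (Q : QuadraticModule A) : Prop :=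
  ∃ G : Set A, G.Countable ∧ G ⊆ Q.carrier ∧
    ∀ Q' : QuadraticModule A, G ⊆ Q'.carrier → Q.carrier ⊆ Q'.carrier

/-- `K_Q`, the set of characters that are nonnegative on `Q`. -/
def nonnegSet (Q : QuadraticModule A) : Set (CharSpace A) :=
  {α | ∀ a ∈ Q.carrier, 0 ≤ α a}

end QuadraticModule

/-- `μ` is supported in `K`: the complement of `K` is a null set. -/
def SupportedIn {X : Type*} {m : MeasurableSpace X} (μ : Measure X) (K : Set X) : Prop :=
  MeasurableSet[m] K ∧ μ Kᶜ = 0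

/-- `μ`, a measure on some σ-algebra `m` on `X(A)`, is `K`-representing for `L`. -/
def IsRepresenting {m : MeasurableSpace (CharSpace A)} (μ : @Measure (CharSpace A) m)
    (L : A →ₗ[ℝ] ℝ) (K : Set (CharSpace A)) : Prop :=
  SupportedIn μ K ∧ ∀ a : A, Integrable (fun α : CharSpace A => α a) μ ∧
    L a = ∫ α : CharSpace A, α a ∂μ

/-- A Radon measure: a Borel measure that is locally finite and inner regular with respect to
compact sets on all Borel sets. -/
def IsRadon {X : Type*} [TopologicalSpace X] [MeasurableSpace X] [BorelSpace X]
    (μ : Measure X) : Prop :=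
  IsLocallyFiniteMeasure μ ∧ μ.InnerRegular

/-- Prokhorov's condition for a family of Borel measures on the spaces `X(S)`, `S` ranging over
the finitely generated subalgebras. -/
def Prokhorov (μ : ∀ S : {S : Subalgebra ℝ A // S.FG}, Measure (CharSpace S.1)) : Prop :=
  ∀ ε : ℝ, 0 < ε → ∃ C : Set (CharSpace A), IsCompact C ∧
    ∀ S : {S : Subalgebra ℝ A // S.FG}, ENNReal.ofReal (1 - ε) ≤ μ S (res S.1 '' C)

/-- The algebra `ℝ[X_i, 1 / (1 + X_i ^ 2) : i ∈ Ω]`: the localization of the polynomial algebra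
at the multiplicative set generated by the polynomials `1 + X_i ^ 2`. -/
abbrev LocPoly (Ω : Type*) : Type _ :=
  Localization (Submonoid.closure
    (Set.range fun i : Ω => (1 + MvPolynomial.X i ^ 2 : MvPolynomial Ω ℝ)))

/-- `μ`, a measure on the cylinder σ-algebra, is `X(A)`-representing for `L` and is supported in
`π_S⁻¹(K_{Q ∩ S})` for every finitely generated subalgebra `S`. -/
def IsCylinderSolution (L : A →ₗ[ℝ] ℝ) (Q : QuadraticModule A)
    (μ : @Measure (CharSpace A) (cylinder A)) : Prop :=
  IsRepresenting μ L Set.univ ∧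
    ∀ S : Subalgebra ℝ A, S.FG → SupportedIn μ (res S ⁻¹' (Q.inter S).nonnegSet)

end CharMoment

end

open Set Topology

noncomputable section

namespace CharMoment

variable {A : Type*} [CommRing A] [Algebra ℝ A]

/-! Call an element of an algebra bounded if `N - a ^ 2` is a sum of squares for some constant `N ≥
0`. On the subalgebra of bounded elements the sums of squares of the whole algebra form an
Archimedean preordering, so its space of positive characters is compact, and Krein–Milman, the Riesz
extension theorem and Riesz–Markov–Kakutani give a regular measure `ν` on it representing `L` there
(`QuadraticModule.exists_measure`).

In `LocPoly Ω` every element is a quotient `c / d` of bounded elements with `d` a unit of the big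
algebra (`exists_denominator`), because `1 / (1 + X_i ^ 2)` and `X_i / (1 + X_i ^ 2)` are bounded.
If `d * e = 1`, representing `L (e ^ 2 * ·)` by `κ` shows that `ν` and `d ^ 2 κ` have the same
moments; hence `d ≠ 0` almost everywhere for `ν`, and `c / d` integrates to `L (e * c)`
(`ae_ne_zero`, `integral_div`). So `ν` can be pushed along `extendChar`, which is only measurable
for the cylinder σ-algebra, to obtain `μ`. Positivity on `Q` passes to `μ` one element at a time
(`ae_nonneg`), then to countably many. Uniqueness holds because bounded elements generate the
cylinder σ-algebra and their moments determine their joint law.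

A Radon solution restricts to `μ` by uniqueness, and its inner regularity gives Prokhorov's
condition. Conversely, that condition and a compactness argument force `ν` to live on a σ-compact
set of characters that extend to `LocPoly Ω` (`le_measure_image_resBounded`); there `extendChar` is
continuous, so the image of `ν` is Radon. -/

instance : AlgHomClass (CharSpace A) ℝ A ℝ := inferInstanceAs (AlgHomClass (A →ₐ[ℝ] ℝ) ℝ A ℝ)

theorem isEmbedding_coe : IsEmbedding (fun (α : CharSpace A) (a : A) => α a) :=
  ⟨⟨rfl⟩, DFunLike.coe_injective⟩

instance : T2Space (CharSpace A) := isEmbedding_coe.t2Space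

theorem continuous_eval (a : A) : Continuous (fun α : CharSpace A => α a) :=
  (continuous_apply a).comp isEmbedding_coe.continuous

theorem apply_smul (α : CharSpace A) (c : ℝ) (a : A) : α (c • a) = c * α a :=
  map_smul α c a

theorem apply_algebraMap (α : CharSpace A) (c : ℝ) : α (algebraMap ℝ A c) = c :=
  AlgHomClass.commutes α c

/-! ### Archimedean quadratic modules: states, characters and representing measures. -/

namespace QuadraticModule

theorem smul_mem (M : QuadraticModule A) {c : ℝ} (hc : 0 ≤ c) {a : A} (ha : a ∈ M.carrier) :
    c • a ∈ M.carrier := by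
  have := M.sq_mul_mem (algebraMap ℝ A (√c)) ha
  rwa [← map_pow, Real.sq_sqrt hc, ← Algebra.smul_def] at this

/-- A quadratic module is Archimedean if every element is bounded above by a constant. -/
def Archimedean (M : QuadraticModule A) : Prop :=
  ∀ a : A, ∃ N : ℝ, algebraMap ℝ A N - a ∈ M.carrier

/-- The states of `A` relative to `M`: normalized linear functionals nonnegative on `M`, viewed
inside the product `A → ℝ`. -/
def states (M : QuadraticModule A) : Set (A → ℝ) :=
  {l | (∀ a b, l (a + b) = l a + l b) ∧ (∀ (c : ℝ) a, l (c • a) = c * l a) ∧ l 1 = 1 ∧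
    ∀ m ∈ M.carrier, 0 ≤ l m}

theorem states_neg {M : QuadraticModule A} {l : A → ℝ} (hl : l ∈ M.states) (a : A) :
    l (-a) = - l a := by
  have := hl.2.1 (-1) a
  simpa using this

theorem states_sub {M : QuadraticModule A} {l : A → ℝ} (hl : l ∈ M.states) (a b : A) :
    l (a - b) = l a - l b := by
  rw [sub_eq_add_neg, hl.1, states_neg hl, sub_eq_add_neg]

theorem states_algebraMap {M : QuadraticModule A} {l : A → ℝ} (hl : l ∈ M.states) (c : ℝ) :
    l (algebraMap ℝ A c) = c := by
  rw [Algebra.algebraMap_eq_smul_one, hl.2.1, hl.2.2.1, mul_one]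

theorem isClosed_states (M : QuadraticModule A) : IsClosed M.states := by
  have h : M.states = (⋂ (a : A) (b : A), {l : A → ℝ | l (a + b) = l a + l b}) ∩
      ((⋂ (c : ℝ) (a : A), {l : A → ℝ | l (c • a) = c * l a}) ∩ ({l : A → ℝ | l 1 = 1} ∩
      ⋂ m ∈ M.carrier, {l : A → ℝ | 0 ≤ l m})) := by
    ext l
    simp only [states, mem_ofPred_eq, mem_inter_iff, mem_iInter]
  rw [h]
  refine IsClosed.inter (isClosed_iInter fun a => isClosed_iInter fun b => ?_)
    (IsClosed.inter (isClosed_iInter fun a => isClosed_iInter fun b => ?_)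
    (IsClosed.inter ?_ (isClosed_iInter fun a => isClosed_iInter fun _ => ?_)))
  · exact isClosed_eq (by fun_prop) (by fun_prop)
  · exact isClosed_eq (by fun_prop) (by fun_prop)
  · exact isClosed_eq (by fun_prop) (by fun_prop)
  · exact isClosed_le (by fun_prop) (by fun_prop)

theorem convex_states (M : QuadraticModule A) : Convex ℝ M.states := by
  intro l hl l' hl' s t hs ht hst
  refine ⟨fun a b => ?_, fun c a => ?_, ?_, fun m hm => ?_⟩
  · simp only [Pi.add_apply, Pi.smul_apply, smul_eq_mul, hl.1, hl'.1]; ring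
  · simp only [Pi.add_apply, Pi.smul_apply, smul_eq_mul, hl.2.1, hl'.2.1]; ring
  · simp only [Pi.add_apply, Pi.smul_apply, smul_eq_mul, hl.2.2.1, hl'.2.2.1]; linarith
  · simp only [Pi.add_apply, Pi.smul_apply, smul_eq_mul]
    have := hl.2.2.2 m hm
    have := hl'.2.2.2 m hm
    positivity

/-- Tychonoff: the Archimedean bounds for `a` and `-a` confine each value `l a` to a fixed interval.
-/
theorem isCompact_states {M : QuadraticModule A} (hM : M.Archimedean) : IsCompact M.states := by
  choose N hN using hM
  refine (isCompact_univ_pi fun a => isCompact_Icc (a := - N (-a)) (b := N a)).of_isClosed_subset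
    M.isClosed_states fun l hl a _ => ?_
  have h1 := hl.2.2.2 _ (hN a)
  have h2 := hl.2.2.2 _ (hN (-a))
  rw [states_sub hl, states_algebraMap hl] at h1 h2
  rw [states_neg hl] at h2
  exact ⟨by linarith, by linarith⟩

/-- An extreme state of a multiplicatively closed Archimedean quadratic module is
multiplicative. -/
theorem map_mul_of_mem_extremePoints {M : QuadraticModule A} (hM : M.Archimedean)
    (hmul : ∀ a ∈ M.carrier, ∀ b ∈ M.carrier, a * b ∈ M.carrier) {l : A → ℝ}
    (hl : l ∈ M.states.extremePoints ℝ) (a b : A) : l (a * b) = l a * l b := by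
  have hs := hl.1
  -- `l` is the convex combination, with weights `l u` and `1 - l u`, of the states `l (u * ·) / l
  -- u` and `l ((1 - u) * ·) / l (1 - u)`; extremality makes the first of them equal to `l`.
  have key : ∀ u ∈ M.carrier, 1 - u ∈ M.carrier → 0 < l u → l u < 1 →
      l (u * b) = l u * l b := by
    intro u hu hu' h0 h1
    have mem : ∀ v ∈ M.carrier, 0 < l v → (fun x => (l v)⁻¹ * l (v * x)) ∈ M.states := by
      intro v hv hv0
      refine ⟨fun a b => ?_, fun c a => ?_, ?_, fun m hm => ?_⟩
      · simp only [mul_add, hs.1]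
      · simp only [mul_smul_comm, hs.2.1]; ring
      · simp only [mul_one]; exact inv_mul_cancel₀ hv0.ne'
      · have := hs.2.2.2 _ (hmul v hv m hm)
        positivity
    have e1 : l (1 - u) = 1 - l u := by rw [states_sub hs, hs.2.2.1]
    have := hl.2 (mem u hu h0) (mem (1 - u) hu' (by rw [e1]; linarith))
      ⟨l u, 1 - l u, h0, by linarith, by ring, ?_⟩
    · rw [← congrFun this b]
      field_simp
    · funext x
      simp only [Pi.add_apply, Pi.smul_apply, smul_eq_mul, e1]
      have h2 : (1 - l u) ≠ 0 := by linarith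
      rw [mul_inv_cancel_left₀ h0.ne', mul_inv_cancel_left₀ h2, ← hs.1]
      congr 1; ring
  obtain ⟨N₁, hN₁⟩ := hM a
  obtain ⟨N₂, hN₂⟩ := hM (-a)
  set N := max (max N₁ N₂) 1
  have hN : 0 < N := lt_of_lt_of_le one_pos (le_max_right _ _)
  have up : ∀ (c : A) (n : ℝ), n ≤ N → algebraMap ℝ A n - c ∈ M.carrier →
      algebraMap ℝ A N - c ∈ M.carrier := by
    intro c n hn hc
    have := M.add_mem hc (M.smul_mem (sub_nonneg.2 hn) M.one_mem)
    rw [← Algebra.algebraMap_eq_smul_one, map_sub] at this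
    convert this using 1
    ring
  have h1 := up a N₁ (by simp [N]) hN₁
  have h2 := up (-a) N₂ (by simp [N]) hN₂
  have b1 := hs.2.2.2 _ h1
  have b2 := hs.2.2.2 _ h2
  rw [states_sub hs, states_algebraMap hs] at b1 b2
  rw [states_neg hs] at b2
  have hcst : algebraMap ℝ A N = N • (1 : A) := Algebra.algebraMap_eq_smul_one N
  -- A general `a` is rescaled to `u = 1 / 2 + a / (4 * N)`: both `u` and `1 - u` lie in `M`, and
  -- `|l a| ≤ N` keeps `l u` within `[1 / 4, 3 / 4]`.
  have g1 := M.smul_mem (c := (4 * N)⁻¹) (by positivity)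
    (M.add_mem (M.smul_mem hN.le M.one_mem) h2)
  have g2 := M.smul_mem (c := (4 * N)⁻¹) (by positivity)
    (M.add_mem (M.smul_mem hN.le M.one_mem) h1)
  rw [hcst] at g1 g2
  have e1 : (4 * N)⁻¹ • (N • (1 : A) + (N • (1 : A) - -a)) =
      (1 / 2 : ℝ) • (1 : A) + (4 * N)⁻¹ • a := by
    rw [sub_neg_eq_add, ← add_assoc, ← add_smul, smul_add, smul_smul]
    congr 2; field_simp; norm_num
  have e2 : (4 * N)⁻¹ • (N • (1 : A) + (N • (1 : A) - a)) =
      1 - ((1 / 2 : ℝ) • (1 : A) + (4 * N)⁻¹ • a) := by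
    rw [← add_sub_assoc, ← add_smul, smul_sub, smul_smul, ← sub_sub]
    congr 1
    rw [eq_sub_iff_add_eq, ← add_smul]
    convert one_smul ℝ (1 : A)
    field_simp; norm_num
  rw [e1] at g1
  rw [e2] at g2
  have lu : l ((1 / 2 : ℝ) • (1 : A) + (4 * N)⁻¹ • a) = 1 / 2 + (4 * N)⁻¹ * l a := by
    rw [hs.1, hs.2.1, hs.2.1, hs.2.2.1, mul_one]
  have hb : |(4 * N)⁻¹ * l a| ≤ 1 / 4 := by
    rw [abs_mul, abs_of_pos (by positivity : 0 < (4 * N)⁻¹), inv_mul_le_iff₀ (by positivity)]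
    rw [abs_le]; constructor <;> linarith
  rw [abs_le] at hb
  have := key _ g1 g2 (by rw [lu]; linarith) (by rw [lu]; linarith)
  rw [lu, add_mul, smul_mul_assoc, smul_mul_assoc, one_mul, hs.1, hs.2.1, hs.2.1] at this
  have h3 : (4 * N)⁻¹ * l (a * b) = (4 * N)⁻¹ * (l a * l b) := by linarith
  exact mul_left_cancel₀ (by positivity) h3

/-- The character attached to a multiplicative state. -/
def charOfState {M : QuadraticModule A} {l : A → ℝ} (hl : l ∈ M.states)
    (hmul : ∀ a b, l (a * b) = l a * l b) : CharSpace A :=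
  AlgHom.ofLinearMap ⟨⟨l, hl.1⟩, hl.2.1⟩ hl.2.2.1 hmul

theorem isCompact_nonnegSet {M : QuadraticModule A} (hM : M.Archimedean) :
    IsCompact M.nonnegSet := by
  rw [isEmbedding_coe.isInducing.isCompact_iff]
  have : (fun (α : CharSpace A) (a : A) => α a) '' M.nonnegSet =
      M.states ∩ ⋂ (a : A) (b : A), {l : A → ℝ | l (a * b) = l a * l b} := by
    ext l
    simp only [mem_image, mem_inter_iff, mem_iInter, mem_ofPred_eq]
    constructor
    · rintro ⟨α, hα, rfl⟩
      exact ⟨⟨map_add α, apply_smul α, map_one α, hα⟩, map_mul α⟩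
    · rintro ⟨hl, hmul⟩
      exact ⟨charOfState hl hmul, hl.2.2.2, rfl⟩
  rw [this]
  refine (isCompact_states hM).inter_right (isClosed_iInter fun a => isClosed_iInter fun b => ?_)
  exact isClosed_eq (by fun_prop) (by fun_prop)

/-- Krein–Milman: the inequality is closed and convex in `l`, and extreme states are characters. -/
theorem nonneg_of_mem_states {M : QuadraticModule A} (hM : M.Archimedean)
    (hmul : ∀ a ∈ M.carrier, ∀ b ∈ M.carrier, a * b ∈ M.carrier) {l : A → ℝ}
    (hl : l ∈ M.states) {a : A} (ha : ∀ β ∈ M.nonnegSet, 0 ≤ β a) : 0 ≤ l a := by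
  have hcl : IsClosed {l : A → ℝ | 0 ≤ l a} := isClosed_le (by fun_prop) (by fun_prop)
  have hcv : Convex ℝ {l : A → ℝ | 0 ≤ l a} := by
    intro l hl l' hl' s t hs ht _
    simp only [mem_ofPred_eq, Pi.add_apply, Pi.smul_apply, smul_eq_mul] at *
    positivity
  have hsub : M.states.extremePoints ℝ ⊆ {l : A → ℝ | 0 ≤ l a} := fun l hl =>
    ha (charOfState hl.1 (map_mul_of_mem_extremePoints hM hmul hl)) hl.1.2.2.2
  rw [← closure_convexHull_extremePoints (isCompact_states hM) M.convex_states] at hl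
  exact closure_minimal (convexHull_min hsub hcv) hcl hl

/-- A linear functional that is nonnegative on a multiplicatively closed Archimedean quadratic
module `M` is nonnegative on all elements that are nonnegative on the characters in `K_M`. -/
theorem nonneg_of_nonneg_on_nonnegSet {M : QuadraticModule A} (hM : M.Archimedean)
    (hmul : ∀ a ∈ M.carrier, ∀ b ∈ M.carrier, a * b ∈ M.carrier) {L : A →ₗ[ℝ] ℝ}
    (hL : ∀ m ∈ M.carrier, 0 ≤ L m) {a : A} (ha : ∀ β ∈ M.nonnegSet, 0 ≤ β a) : 0 ≤ L a := by
  -- If `L 1 = 0`, no normalization is possible, but then `N + a ∈ M` already gives `0 ≤ L a`.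
  rcases (hL 1 M.one_mem).eq_or_lt with h | h
  · obtain ⟨N, hN⟩ := hM (-a)
    have := hL _ hN
    rw [map_sub, map_neg, Algebra.algebraMap_eq_smul_one, map_smul, ← h] at this
    simpa using this
  · have : (fun x => (L 1)⁻¹ * L x) ∈ M.states := by
      refine ⟨fun a b => ?_, fun c a => ?_, inv_mul_cancel₀ h.ne', fun m hm => ?_⟩
      · simp only [map_add, mul_add]
      · simp only [map_smul, smul_eq_mul]; ring
      · have := hL m hm
        positivity
    exact nonneg_of_mul_nonneg_right (nonneg_of_mem_states hM hmul this ha) (inv_pos.2 h)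

/-- Evaluation at the characters of `K_M` as an algebra homomorphism to continuous functions. -/
def gelfand (M : QuadraticModule A) : A →ₐ[ℝ] C(M.nonnegSet, ℝ) where
  toFun a := ⟨fun β => β.1 a, (continuous_eval a).comp continuous_subtype_val⟩
  map_one' := by ext β; exact map_one β.1
  map_zero' := by ext β; exact map_zero β.1
  map_mul' a b := by ext β; exact map_mul β.1 a b
  map_add' a b := by ext β; exact map_add β.1 a b
  commutes' c := by ext β; exact apply_algebraMap β.1 c

/-- Positive functionals on an Archimedean preordering are represented by a regular measure on
the compact set of its characters. -/
theorem exists_measure {M : QuadraticModule A} (hM : M.Archimedean)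
    (hmul : ∀ a ∈ M.carrier, ∀ b ∈ M.carrier, a * b ∈ M.carrier) {L : A →ₗ[ℝ] ℝ}
    (hL : ∀ m ∈ M.carrier, 0 ≤ L m) :
    ∃ ν : Measure M.nonnegSet, ν.Regular ∧ IsFiniteMeasure ν ∧
      ∀ a, ∫ β, β.1 a ∂ν = L a := by
  have : CompactSpace M.nonnegSet := isCompact_iff_compactSpace.1 (isCompact_nonnegSet hM)
  have pos : ∀ a, 0 ≤ M.gelfand a → 0 ≤ L a := fun a ha =>
    nonneg_of_nonneg_on_nonnegSet hM hmul hL fun β hβ => ha ⟨β, hβ⟩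
  -- `L` factors through the image of `gelfand`; positivity then allows an extension to all
  -- continuous functions, since the constants in the image dominate each of them.
  have ker : LinearMap.ker M.gelfand.toLinearMap ≤ LinearMap.ker L := by
    intro a ha
    rw [LinearMap.mem_ker] at ha ⊢
    have ha' : M.gelfand a = 0 := ha
    refine le_antisymm ?_ (pos a ha'.ge)
    have := pos (-a) (by rw [map_neg, ha', neg_zero])
    rw [map_neg] at this
    linarith
  obtain ⟨g, hg⟩ : ∃ g : LinearMap.range M.gelfand.toLinearMap →ₗ[ℝ] ℝ,
      ∀ a, g ⟨M.gelfand a, a, rfl⟩ = L a := by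
    refine ⟨((LinearMap.ker M.gelfand.toLinearMap).liftQ L ker).comp
      M.gelfand.toLinearMap.quotKerEquivRange.symm.toLinearMap, fun a => ?_⟩
    have : M.gelfand.toLinearMap.quotKerEquivRange.symm ⟨M.gelfand a, a, rfl⟩ =
        Submodule.Quotient.mk a := by
      rw [LinearEquiv.symm_apply_eq]; rfl
    simp only [LinearMap.comp_apply, LinearEquiv.coe_coe, this]
    rfl
  obtain ⟨G, hG, hGpos⟩ := riesz_extension (E := C(M.nonnegSet, ℝ))
    (PointedCone.positive ℝ C(M.nonnegSet, ℝ)) ⟨LinearMap.range M.gelfand.toLinearMap, g⟩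
    (by
      rintro ⟨_, a, rfl⟩ ha
      exact (pos a ha).trans_eq (hg a).symm)
    (by
      intro f
      refine ⟨⟨M.gelfand (algebraMap ℝ A ‖f‖), _, rfl⟩, ?_⟩
      change 0 ≤ M.gelfand (algebraMap ℝ A ‖f‖) + f
      intro β
      have := (abs_le.1 (f.norm_coe_le_norm β)).1
      change 0 ≤ β.1 (algebraMap ℝ A ‖f‖) + f β
      rw [apply_algebraMap]
      linarith)
  let Λ₀ : CompactlySupportedContinuousMap M.nonnegSet ℝ →ₗ[ℝ] ℝ :=
    { toFun := fun f => G f.toContinuousMap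
      map_add' := fun f h => map_add G f.toContinuousMap h.toContinuousMap
      map_smul' := fun c f => map_smul G c f.toContinuousMap }
  let Λ : CompactlySupportedContinuousMap M.nonnegSet ℝ →ₚ[ℝ] ℝ :=
    PositiveLinearMap.mk₀ Λ₀ (fun f hf => hGpos _ fun β => hf β)
  refine ⟨RealRMK.rieszMeasure Λ, inferInstance, inferInstance, fun a => ?_⟩
  have := RealRMK.integral_rieszMeasure Λ
    (CompactlySupportedContinuousMap.continuousMapEquiv (M.gelfand a))
  refine this.trans ?_
  exact (hG ⟨M.gelfand a, a, rfl⟩).trans (hg a)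

end QuadraticModule

/-! ### Moments of bounded functions determine their joint law. -/

/-- Two finite measures that assign the same integrals to the members of an algebra of bounded
measurable functions have the same joint distribution of these functions. -/
theorem map_eq_of_integral_eq_of_bounded {X : Type*} {m : MeasurableSpace X}
    (e : A →ₐ[ℝ] (X → ℝ)) (he : ∀ a, Measurable (e a))
    (hb : ∀ a, ∃ N : ℝ, ∀ x, |e a x| ≤ N) {μ ν : Measure X} [IsFiniteMeasure μ]
    [IsFiniteMeasure ν] (h : ∀ a, ∫ x, e a x ∂μ = ∫ x, e a x ∂ν) :
    μ.map (fun x a => e a x) = ν.map (fun x a => e a x) := by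
  have hE : Measurable (fun x a => e a x) := measurable_pi_lambda _ he
  -- It suffices to compare finite-dimensional marginals. These live on a compact cube `T`, where
  -- the polynomials in the coordinates form a point-separating algebra.
  refine IsProjectiveLimit.unique (P := fun I : Finset A =>
    (μ.map (fun x a => e a x)).map I.restrict) (fun I => rfl) (fun I => ?_)
  choose N hN using hb
  let T := (i : I) → Icc (-(N i)) (N i)
  let f : X → T := fun x i => ⟨e i x, abs_le.1 (hN i x)⟩
  have hf : Measurable f := measurable_pi_lambda _ fun i => (he i).subtype_mk
  have hr : Measurable (I.restrict : (A → ℝ) → (I → ℝ)) := Finset.measurable_restrict I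
  let k : T → (I → ℝ) := fun t i => (t i : ℝ)
  have hk : Measurable k :=
    measurable_pi_lambda _ fun i => measurable_subtype_coe.comp (measurable_pi_apply i)
  suffices hT : μ.map f = ν.map f by
    beta_reduce
    rw [Measure.map_map hr hE, Measure.map_map hr hE]
    change ν.map (k ∘ f) = μ.map (k ∘ f)
    rw [← Measure.map_map hk hf, ← Measure.map_map hk hf, hT]
  let c : I → BoundedContinuousFunction T ℝ := fun i =>
    BoundedContinuousFunction.mkOfCompact
      ⟨fun t => (t i : ℝ), continuous_subtype_val.comp (continuous_apply i)⟩
  let S : StarSubalgebra ℝ (BoundedContinuousFunction T ℝ) :=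
    { (MvPolynomial.aeval (R := ℝ) c).range with
      star_mem' := fun {g} hg => hg }
  have hS : ∀ p : MvPolynomial I ℝ, ∀ x, MvPolynomial.aeval (R := ℝ) c p (f x) =
      e (MvPolynomial.aeval (R := ℝ) (fun i : I => (i : A)) p) x := by
    intro p x
    induction p using MvPolynomial.induction_on with
    | C r =>
      simp only [MvPolynomial.algHom_C, AlgHom.commutes, Pi.algebraMap_apply]
      rfl
    | add p q hp hq =>
      simp only [map_add, Pi.add_apply, BoundedContinuousFunction.add_apply, hp, hq]
    | mul_X p i hp =>
      simp only [map_mul, Pi.mul_apply, BoundedContinuousFunction.mul_apply, hp,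
        MvPolynomial.aeval_X]
      rfl
  refine ext_of_forall_mem_subalgebra_integral_eq_of_pseudoEMetric_complete_countable
    (𝕜 := ℝ) (A := S) ?_ ?_
  · intro t t' htt'
    obtain ⟨i, hi⟩ := Function.ne_iff.1 htt'
    refine ⟨_, ⟨_, ⟨c i, ⟨MvPolynomial.X i, MvPolynomial.aeval_X _ _⟩, rfl⟩, rfl⟩, ?_⟩
    exact fun h => hi (Subtype.ext h)
  · rintro _ ⟨p, rfl⟩
    rw [integral_map hf.aemeasurable (Continuous.aestronglyMeasurable (by fun_prop)),
      integral_map hf.aemeasurable (Continuous.aestronglyMeasurable (by fun_prop))]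
    exact (integral_congr_ae (.of_forall fun x => hS p x)).trans
      ((h _).trans (integral_congr_ae (.of_forall fun x => (hS p x).symm)))

/-- Evaluation as an algebra homomorphism into the functions on the character space. -/
def evalHom (X : Set (CharSpace A)) : A →ₐ[ℝ] (X → ℝ) where
  toFun a := fun β => β.1 a
  map_one' := by ext β; exact map_one β.1
  map_zero' := by ext β; exact map_zero β.1
  map_mul' a b := by ext β; exact map_mul β.1 a b
  map_add' a b := by ext β; exact map_add β.1 a b
  commutes' c := by ext β; exact apply_algebraMap β.1 c

/-! ### Borel and cylinder σ-algebras as pullbacks of product σ-algebras. -/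

theorem borel_eq_comap_of_fg (hA : (⊤ : Subalgebra ℝ A).FG) :
    (inferInstance : MeasurableSpace (CharSpace A)) =
      MeasurableSpace.comap (fun α a => α a) MeasurableSpace.pi ∧
    SecondCountableTopology (CharSpace A) := by
  obtain ⟨G, hG⟩ := hA
  -- Finitely many generators already induce the topology, so everything is pulled back from the
  -- finite-dimensional space `G → ℝ`, where Borel and product σ-algebras agree.
  have hind : IsInducing (fun (α : CharSpace A) (g : G) => α g) := by
    refine ⟨le_antisymm ?_ ?_⟩
    · exact (continuous_pi fun g : G => continuous_eval (g : A)).le_induced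
    · let _t : TopologicalSpace (CharSpace A) :=
        TopologicalSpace.induced (fun (α : CharSpace A) (g : G) => α g) Pi.topologicalSpace
      have hd : Continuous (fun (α : CharSpace A) (g : G) => α g) := continuous_induced_dom
      have hc : ∀ a : A, Continuous fun α : CharSpace A => α a := by
        intro a
        have ha : a ∈ Algebra.adjoin ℝ (G : Set A) := by rw [hG]; trivial
        induction ha using Algebra.adjoin_induction with
        | mem x hx => exact (continuous_apply (⟨x, hx⟩ : G)).comp hd
        | algebraMap r => simp only [apply_algebraMap]; exact continuous_const
        | add x y _ _ hx hy => simp only [map_add]; exact hx.add hy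
        | mul x y _ _ hx hy => simp only [map_mul]; exact hx.mul hy
      exact (continuous_pi hc).le_induced
  refine ⟨le_antisymm ?_ ?_, hind.secondCountableTopology⟩
  · have : (inferInstance : MeasurableSpace (CharSpace A)) =
        MeasurableSpace.comap (fun (α : CharSpace A) (g : G) => α g) MeasurableSpace.pi := by
      change borel (CharSpace A) = _
      rw [hind.eq_induced, borel_comap, BorelSpace.measurable_eq (α := G → ℝ)]
    rw [this]
    refine Measurable.comap_le (@measurable_pi_lambda _ _ _ (_) _ _ fun g => ?_)
    exact (measurable_pi_apply g.1).comp (comap_measurable _)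
  · exact Measurable.comap_le (measurable_pi_lambda _ fun a => (continuous_eval a).measurable)

theorem cylinder_eq_comap :
    cylinder A = MeasurableSpace.comap (fun α a => α a) MeasurableSpace.pi := by
  refine le_antisymm (iSup_le fun S => ?_) ?_
  · have hS : (⊤ : Subalgebra ℝ S.1).FG := S.1.fg_top.2 S.2
    rw [(borel_eq_comap_of_fg hS).1, MeasurableSpace.comap_comp]
    refine Measurable.comap_le (@measurable_pi_lambda _ _ _ (_) _ _ fun a => ?_)
    exact (measurable_pi_apply a.1).comp (comap_measurable _)
  · refine Measurable.comap_le (@measurable_pi_lambda _ _ _ (_) _ _ fun a => ?_)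
    have hS : (Algebra.adjoin ℝ {a} : Subalgebra ℝ A).FG := ⟨{a}, by simp⟩
    have : (fun α : CharSpace A => α a) =
        (fun β : CharSpace (Algebra.adjoin ℝ {a} : Subalgebra ℝ A) =>
          β ⟨a, Algebra.self_mem_adjoin_singleton ℝ a⟩) ∘ res (Algebra.adjoin ℝ {a}) := rfl
    rw [this]
    exact (continuous_eval _).measurable.comp (measurable_res hS)

theorem measurable_eval_cylinder (a : A) :
    Measurable[cylinder A] (fun α : CharSpace A => α a) := by
  rw [cylinder_eq_comap]
  exact (measurable_pi_apply a).comp (comap_measurable _)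

theorem measurable_cylinder_iff {X : Type*} {m : MeasurableSpace X} {f : X → CharSpace A} :
    Measurable[m, cylinder A] f ↔ ∀ a, Measurable fun x => f x a := by
  rw [cylinder_eq_comap, measurable_comap_iff]
  exact measurable_pi_iff

theorem cylinder_le_borel : cylinder A ≤ (inferInstance : MeasurableSpace (CharSpace A)) := by
  rw [cylinder_eq_comap]
  exact Measurable.comap_le (measurable_pi_lambda _ fun a => (continuous_eval a).measurable)

/-! ### Sums of squares and the subalgebra of bounded elements. -/

omit [Algebra ℝ A] in
theorem isSumSq_sq (a : A) : IsSumSq (a ^ 2) := by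
  rw [sq]; exact IsSumSq.mul_self a

theorem isSumSq_algebraMap {c : ℝ} (hc : 0 ≤ c) : IsSumSq (algebraMap ℝ A c) := by
  have := isSumSq_sq (algebraMap ℝ A (√c))
  rwa [← map_pow, Real.sq_sqrt hc] at this

theorem nonneg_of_isSumSq (α : CharSpace A) {a : A} (ha : IsSumSq a) : 0 ≤ α a := by
  induction ha with
  | zero => simp
  | sq_add a _ ih => rw [map_add, map_mul]; exact add_nonneg (mul_self_nonneg _) ih

omit [Algebra ℝ A] in
theorem QuadraticModule.isSumSq_mul_mem (Q : QuadraticModule A) {s q : A} (hs : IsSumSq s)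
    (hq : q ∈ Q.carrier) : s * q ∈ Q.carrier := by
  induction hs with
  | zero => simpa using Q.sq_mul_mem 0 hq
  | sq_add a _ ih =>
    rw [add_mul, ← sq]
    exact Q.add_mem (Q.sq_mul_mem a hq) ih

variable (A) in
/-- The quadratic module of sums of squares. -/
def sumSq : QuadraticModule A where
  carrier := {a | IsSumSq a}
  one_mem := IsSumSq.one
  add_mem := IsSumSq.add
  sq_mul_mem a _ hb := (isSumSq_sq a).mul hb

variable (A) in
/-- The subalgebra of elements that are bounded with respect to the sums of squares. -/
def bounded : Subalgebra ℝ A where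
  carrier := {a | ∃ N : ℝ, 0 ≤ N ∧ IsSumSq (algebraMap ℝ A N - a ^ 2)}
  mul_mem' := by
    rintro a b ⟨N, hN, ha⟩ ⟨K, hK, hb⟩
    refine ⟨N * K, mul_nonneg hN hK, ?_⟩
    have : algebraMap ℝ A (N * K) - (a * b) ^ 2 =
        algebraMap ℝ A N * (algebraMap ℝ A K - b ^ 2) + b ^ 2 * (algebraMap ℝ A N - a ^ 2) := by
      rw [map_mul]; ring
    rw [this]
    exact ((isSumSq_algebraMap hN).mul hb).add ((isSumSq_sq b).mul ha)
  add_mem' := by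
    rintro a b ⟨N, hN, ha⟩ ⟨K, hK, hb⟩
    -- Parallelogram law: `(a + b) ^ 2 + (a - b) ^ 2 = 2 * a ^ 2 + 2 * b ^ 2`.
    refine ⟨2 * N + 2 * K, by positivity, ?_⟩
    have : algebraMap ℝ A (2 * N + 2 * K) - (a + b) ^ 2 =
        algebraMap ℝ A 2 * ((algebraMap ℝ A N - a ^ 2) + (algebraMap ℝ A K - b ^ 2)) +
          (a - b) ^ 2 := by
      rw [map_add, map_mul, map_mul, map_ofNat]; ring
    rw [this]
    exact ((isSumSq_algebraMap (by norm_num)).mul (ha.add hb)).add (isSumSq_sq _)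
  algebraMap_mem' r := ⟨r ^ 2, sq_nonneg r, by rw [map_pow, sub_self]; exact IsSumSq.zero⟩

variable (A) in
/-- The sums of squares of `A` inside the subalgebra of bounded elements. -/
def boundedSumSq : QuadraticModule (bounded A) := (sumSq A).inter (bounded A)

theorem boundedSumSq_archimedean : (boundedSumSq A).Archimedean := by
  rintro ⟨a, N, hN, ha⟩
  -- From `N + 1 - 2 * a = (N - a ^ 2) + (1 - a) ^ 2`.
  refine ⟨1 / 2 * (N + 1), ?_⟩
  change IsSumSq (algebraMap ℝ A (1 / 2 * (N + 1)) - a)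
  have h2 : algebraMap ℝ A (1 / 2) * 2 = 1 := by
    rw [← map_ofNat (algebraMap ℝ A) 2, ← map_mul]; norm_num
  have : algebraMap ℝ A (1 / 2 * (N + 1)) - a =
      algebraMap ℝ A (1 / 2) * ((algebraMap ℝ A N - a ^ 2) + (1 - a) ^ 2) := by
    rw [map_mul, map_add, map_one]
    linear_combination a * h2
  rw [this]
  exact (isSumSq_algebraMap (by norm_num)).mul (ha.add (isSumSq_sq _))

theorem boundedSumSq_mul_mem : ∀ a ∈ (boundedSumSq A).carrier, ∀ b ∈ (boundedSumSq A).carrier,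
    a * b ∈ (boundedSumSq A).carrier :=
  fun _ ha _ hb => IsSumSq.mul ha hb

theorem exists_abs_le (a : bounded A) :
    ∃ N : ℝ, ∀ β ∈ (boundedSumSq A).nonnegSet, |β a| ≤ N := by
  obtain ⟨N, hN⟩ := boundedSumSq_archimedean a
  obtain ⟨K, hK⟩ := boundedSumSq_archimedean (-a)
  refine ⟨max N K, fun β hβ => ?_⟩
  have h1 := hβ _ hN
  have h2 := hβ _ hK
  rw [map_sub, apply_algebraMap] at h1 h2
  rw [map_neg] at h2
  exact abs_le'.2 ⟨by linarith [le_max_left N K], by linarith [le_max_right N K]⟩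

theorem res_mem_nonnegSet (α : CharSpace A) : res (bounded A) α ∈ (boundedSumSq A).nonnegSet :=
  fun _ ha => nonneg_of_isSumSq α ha

/-! ### Algebra of `LocPoly Ω`: its characters and its bounded elements. -/

section LocPoly

variable {Ω : Type*}

/-- The denominators of `LocPoly Ω`. -/
abbrev denominators (Ω : Type*) : Submonoid (MvPolynomial Ω ℝ) :=
  Submonoid.closure (Set.range fun i : Ω => (1 + MvPolynomial.X i ^ 2 : MvPolynomial Ω ℝ))

theorem aeval_denominators_pos (t : Ω → ℝ) (s : denominators Ω) :
    0 < MvPolynomial.aeval (R := ℝ) t (s : MvPolynomial Ω ℝ) := by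
  obtain ⟨s, hs⟩ := s
  induction hs using Submonoid.closure_induction with
  | mem x hx =>
    obtain ⟨i, rfl⟩ := hx
    simp only [map_add, map_one, map_pow, MvPolynomial.aeval_X]
    positivity
  | one => simp
  | mul x y _ _ hx hy => simp only [map_mul] at *; positivity

/-- The character of `LocPoly Ω` given by evaluation at a point. -/
def pointChar (t : Ω → ℝ) : CharSpace (LocPoly Ω) :=
  IsLocalization.liftAlgHom (M := denominators Ω) (f := MvPolynomial.aeval (R := ℝ) t)
    fun s => (aeval_denominators_pos t s).ne'.isUnit

/-- The coordinate functions. -/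
def coord (i : Ω) : LocPoly Ω := algebraMap (MvPolynomial Ω ℝ) _ (MvPolynomial.X i)

/-- The element `1 / (1 + X_i ^ 2)`. -/
def recip (i : Ω) : LocPoly Ω :=
  IsLocalization.mk' _ 1 (⟨_, Submonoid.subset_closure ⟨i, rfl⟩⟩ : denominators Ω)

theorem recip_mul (i : Ω) : recip i * (1 + coord i ^ 2) = 1 := by
  have := IsLocalization.mk'_spec (LocPoly Ω) (1 : MvPolynomial Ω ℝ)
    (⟨_, Submonoid.subset_closure ⟨i, rfl⟩⟩ : denominators Ω)
  rw [map_add, map_pow, map_one] at this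
  exact this

theorem pointChar_algebraMap (t : Ω → ℝ) (p : MvPolynomial Ω ℝ) :
    pointChar t (algebraMap _ _ p) = MvPolynomial.aeval (R := ℝ) t p :=
  IsLocalization.lift_eq (M := denominators Ω) (g := (MvPolynomial.aeval (R := ℝ) t).toRingHom)
    (fun s => (aeval_denominators_pos t s).ne'.isUnit) p

theorem pointChar_coord (t : Ω → ℝ) (i : Ω) : pointChar t (coord i) = t i := by
  rw [coord, pointChar_algebraMap, MvPolynomial.aeval_X]

theorem apply_recip (α : CharSpace (LocPoly Ω)) (i : Ω) :
    α (recip i) * (1 + α (coord i) ^ 2) = 1 := by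
  have := congrArg α (recip_mul i)
  simpa only [map_mul, map_add, map_pow, map_one] using this

/-- Induction principle: `LocPoly Ω` is generated by the coordinates and the elements
`1 / (1 + X_i ^ 2)`. -/
theorem locPoly_induction {P : LocPoly Ω → Prop} (hc : ∀ c : ℝ, P (algebraMap ℝ _ c))
    (ha : ∀ a b, P a → P b → P (a + b)) (hm : ∀ a b, P a → P b → P (a * b))
    (hx : ∀ i, P (coord i)) (hy : ∀ i, P (recip i)) (b : LocPoly Ω) : P b := by
  obtain ⟨p, s, rfl⟩ := IsLocalization.exists_mk'_eq (denominators Ω) b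
  rw [IsLocalization.mk'_eq_mul_mk'_one]
  refine hm _ _ ?_ ?_
  · induction p using MvPolynomial.induction_on with
    | C r =>
      have : algebraMap (MvPolynomial Ω ℝ) (LocPoly Ω) (MvPolynomial.C r) = algebraMap ℝ _ r :=
        (IsScalarTower.algebraMap_apply ℝ (MvPolynomial Ω ℝ) (LocPoly Ω) r).symm
      rw [this]; exact hc r
    | add p q hp hq => rw [map_add]; exact ha _ _ hp hq
    | mul_X p i hp => rw [map_mul]; exact hm _ _ hp (hx i)
  · obtain ⟨s, hs⟩ := s
    induction hs using Submonoid.closure_induction with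
    | mem x hx => obtain ⟨i, rfl⟩ := hx; exact hy i
    | one =>
      have : IsLocalization.mk' (LocPoly Ω) 1 (1 : denominators Ω) = algebraMap ℝ _ 1 := by
        rw [IsLocalization.mk'_one, map_one, map_one]
      exact this ▸ hc 1
    | mul x y hx hy h1 h2 =>
      have : IsLocalization.mk' (LocPoly Ω) 1 ((⟨x, hx⟩ : denominators Ω) * ⟨y, hy⟩) =
          IsLocalization.mk' (LocPoly Ω) 1 (⟨x, hx⟩ : denominators Ω) *
            IsLocalization.mk' (LocPoly Ω) 1 (⟨y, hy⟩ : denominators Ω) := by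
        rw [← IsLocalization.mk'_mul, one_mul]
      exact this ▸ hm _ _ h1 h2

theorem charSpace_ext {α α' : CharSpace (LocPoly Ω)} (h : ∀ i, α (coord i) = α' (coord i)) :
    α = α' := by
  refine DFunLike.ext _ _ fun b => ?_
  induction b using locPoly_induction with
  | hc c => rw [apply_algebraMap, apply_algebraMap]
  | ha a b h1 h2 => rw [map_add, map_add, h1, h2]
  | hm a b h1 h2 => rw [map_mul, map_mul, h1, h2]
  | hx i => exact h i
  | hy i =>
    have h1 := apply_recip α i
    have h2 := apply_recip α' i
    rw [← h] at h2
    have : (1 + α (coord i) ^ 2) ≠ 0 := by positivity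
    exact mul_right_cancel₀ this (h1.trans h2.symm)

/-- This circle equation survives for characters of the bounded elements, and where `recip i` is
nonzero it forces `extendChar` to keep the value at `recip i`. -/
theorem recip_sub_sq (i : Ω) : recip i ^ 2 + (coord i * recip i) ^ 2 = recip i := by
  linear_combination recip i * recip_mul i

/-- Expand `1 = (recip i * (1 + coord i ^ 2)) ^ 2`: both `recip i ^ 2` and `(coord i * recip i) ^ 2`
occur in a sum of squares equal to `1`. -/
theorem recip_mem_bounded (i : Ω) : recip i ∈ bounded (LocPoly Ω) := by
  refine ⟨1, zero_le_one, ?_⟩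
  have : algebraMap ℝ (LocPoly Ω) 1 - recip i ^ 2 =
      (coord i * recip i) ^ 2 + (coord i * recip i) ^ 2 + (coord i ^ 2 * recip i) ^ 2 := by
    rw [map_one]
    linear_combination (-(recip i * (1 + coord i ^ 2)) - 1) * recip_mul i
  rw [this]
  exact ((isSumSq_sq _).add (isSumSq_sq _)).add (isSumSq_sq _)

theorem coord_mul_recip_mem_bounded (i : Ω) : coord i * recip i ∈ bounded (LocPoly Ω) := by
  refine ⟨1, zero_le_one, ?_⟩
  have : algebraMap ℝ (LocPoly Ω) 1 - (coord i * recip i) ^ 2 =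
      recip i ^ 2 + (coord i * recip i) ^ 2 + (coord i ^ 2 * recip i) ^ 2 := by
    rw [map_one]
    linear_combination (-(recip i * (1 + coord i ^ 2)) - 1) * recip_mul i
  rw [this]
  exact ((isSumSq_sq _).add (isSumSq_sq _)).add (isSumSq_sq _)

/-- The character of `LocPoly Ω` attached to a character of the bounded elements; coordinates at
which the latter character lies at infinity are set to zero. -/
def extendChar (β : CharSpace (bounded (LocPoly Ω))) : CharSpace (LocPoly Ω) :=
  pointChar fun i => β ⟨_, coord_mul_recip_mem_bounded i⟩ / β ⟨_, recip_mem_bounded i⟩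

theorem extendChar_res (α : CharSpace (LocPoly Ω)) : extendChar (res (bounded _) α) = α := by
  refine charSpace_ext fun i => ?_
  rw [extendChar, pointChar_coord, res_apply, res_apply, map_mul]
  have h : α (recip i) ≠ 0 := fun h => by simpa [h] using apply_recip α i
  exact mul_div_cancel_right₀ _ h

/-- Every element of `LocPoly Ω` is a quotient of bounded elements. -/
theorem exists_denominator (b : LocPoly Ω) : ∃ (d c : bounded (LocPoly Ω)) (e : LocPoly Ω),
    (d : LocPoly Ω) * e = 1 ∧ (c : LocPoly Ω) = d * b ∧
      ∀ β : CharSpace (bounded (LocPoly Ω)), β d ≠ 0 → extendChar β b * β d = β c := by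
  induction b using locPoly_induction with
  | hc c =>
    refine ⟨1, algebraMap ℝ _ c, 1, by simp, ?_, fun β _ => ?_⟩
    · rw [OneMemClass.coe_one, one_mul]; rfl
    · rw [apply_algebraMap, apply_algebraMap, map_one, mul_one]
  | ha a b h1 h2 =>
    obtain ⟨d, c, e, hde, hc, h⟩ := h1
    obtain ⟨d', c', e', hde', hc', h'⟩ := h2
    refine ⟨d * d', d' * c + d * c', e * e', ?_, ?_, fun β hβ => ?_⟩
    · rw [MulMemClass.coe_mul]; linear_combination (d' * e' : LocPoly Ω) * hde + hde'
    · rw [AddMemClass.coe_add, MulMemClass.coe_mul, MulMemClass.coe_mul, MulMemClass.coe_mul,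
        hc, hc']; ring
    · simp only [map_add, map_mul] at hβ ⊢
      rw [← h β (left_ne_zero_of_mul hβ), ← h' β (right_ne_zero_of_mul hβ)]; ring
  | hm a b h1 h2 =>
    obtain ⟨d, c, e, hde, hc, h⟩ := h1
    obtain ⟨d', c', e', hde', hc', h'⟩ := h2
    refine ⟨d * d', c * c', e * e', ?_, ?_, fun β hβ => ?_⟩
    · rw [MulMemClass.coe_mul]; linear_combination (d' * e' : LocPoly Ω) * hde + hde'
    · rw [MulMemClass.coe_mul, MulMemClass.coe_mul, hc, hc']; ring
    · simp only [map_mul] at hβ ⊢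
      rw [← h β (left_ne_zero_of_mul hβ), ← h' β (right_ne_zero_of_mul hβ)]; ring
  | hx i =>
    refine ⟨⟨_, recip_mem_bounded i⟩, ⟨_, coord_mul_recip_mem_bounded i⟩, 1 + coord i ^ 2,
      recip_mul i, mul_comm _ _, fun β hβ => ?_⟩
    rw [extendChar, pointChar_coord, div_mul_cancel₀ _ hβ]
  | hy i =>
    refine ⟨⟨_, recip_mem_bounded i⟩, ⟨_, recip_mem_bounded i⟩ ^ 2, 1 + coord i ^ 2,
      recip_mul i, sq _, fun β hβ => ?_⟩
    have h1 := apply_recip (extendChar β) i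
    rw [extendChar, pointChar_coord, ← extendChar] at h1
    have h2 : (⟨_, recip_mem_bounded i⟩ ^ 2 + ⟨_, coord_mul_recip_mem_bounded i⟩ ^ 2 :
        bounded (LocPoly Ω)) = ⟨_, recip_mem_bounded i⟩ := Subtype.ext (recip_sub_sq i)
    have h3 := congrArg β h2
    rw [map_add, map_pow, map_pow] at h3
    rw [map_pow]
    set Y := β ⟨_, recip_mem_bounded i⟩
    set Z := β ⟨_, coord_mul_recip_mem_bounded i⟩
    field_simp at h1
    rw [h3] at h1
    have h4 : extendChar β (recip i) = Y := mul_right_cancel₀ hβ (by rw [h1, sq])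
    rw [h4, sq]

end LocPoly

/-! ### The measure on characters of the bounded elements: denominators and signs. -/

variable (A) in
/-- The compact space of characters of the bounded elements that are nonnegative on sums of
squares. -/
abbrev BoundedChars : Type _ := (boundedSumSq A).nonnegSet

instance : CompactSpace (BoundedChars A) :=
  isCompact_iff_compactSpace.1 (QuadraticModule.isCompact_nonnegSet boundedSumSq_archimedean)

theorem continuous_eval_subtype {X : Set (CharSpace A)} (a : A) :
    Continuous fun β : X => β.1 a :=
  (continuous_eval a).comp continuous_subtype_val

theorem integrable_of_continuous {X : Type*} [TopologicalSpace X] [CompactSpace X]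
    [MeasurableSpace X] [OpensMeasurableSpace X] {μ : Measure X} [IsFiniteMeasure μ] {f : X → ℝ}
    (hf : Continuous f) : Integrable f μ :=
  (BoundedContinuousFunction.mkOfCompact ⟨f, hf⟩).integrable μ

/-- Only the pushforwards are compared, since moments see the product σ-algebra, which may be
coarser than the Borel one. -/
theorem boundedChars_map_eq {μ ν : Measure (BoundedChars A)} [IsFiniteMeasure μ]
    [IsFiniteMeasure ν] (h : ∀ a : bounded A, ∫ β, β.1 a ∂μ = ∫ β, β.1 a ∂ν) :
    μ.map (fun β a => β.1 a) = ν.map (fun β a => β.1 a) :=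
  map_eq_of_integral_eq_of_bounded (evalHom (boundedSumSq A).nonnegSet)
    (fun a => (continuous_eval_subtype a).measurable)
    (fun a => (exists_abs_le a).imp fun _ h β => h β.1 β.2) h

theorem measurable_boundedChars :
    Measurable (fun (β : BoundedChars A) (a : bounded A) => β.1 a) :=
  measurable_pi_lambda _ fun a => (continuous_eval_subtype a).measurable

/-- A functional on `A` that is nonnegative on sums of squares is represented on the bounded
elements by a regular measure, also after localization at an element `c` for which the functional
is nonnegative on `c` times sums of squares. -/
theorem exists_boundedChars_measure {L : A →ₗ[ℝ] ℝ} (c : A)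
    (hL : ∀ s, IsSumSq s → 0 ≤ L (c * s)) :
    ∃ ν : Measure (BoundedChars A), ν.Regular ∧ IsFiniteMeasure ν ∧
      ∀ a : bounded A, ∫ β, β.1 a ∂ν = L (c * a) :=
  QuadraticModule.exists_measure boundedSumSq_archimedean boundedSumSq_mul_mem
    (L := (L ∘ₗ LinearMap.mulLeft ℝ c) ∘ₗ (bounded A).val.toLinearMap) fun m hm => hL m hm

theorem isFiniteMeasure_withDensity_continuous {X : Type*} [TopologicalSpace X] [CompactSpace X]
    [MeasurableSpace X] [OpensMeasurableSpace X] (μ : Measure X) [IsFiniteMeasure μ] {f : X → ℝ}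
    (hf : Continuous f) : IsFiniteMeasure (μ.withDensity fun x => ((f x).toNNReal : ENNReal)) :=
  isFiniteMeasure_withDensity_ofReal (integrable_of_continuous hf).2

variable {L : A →ₗ[ℝ] ℝ} {ν : Measure (BoundedChars A)} [IsFiniteMeasure ν]

/-- If `d` is invertible in `A`, then the measure representing `L` on the bounded elements has a
density with respect to the measure representing the localization of `L` at `d⁻²`. -/
theorem exists_map_eq_withDensity (hL : ∀ s, IsSumSq s → 0 ≤ L s)
    (hν : ∀ a : bounded A, ∫ β, β.1 a ∂ν = L a) {d : bounded A} {e : A} (hde : (d : A) * e = 1) :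
    ∃ κ : Measure (BoundedChars A), IsFiniteMeasure κ ∧
      (∀ a : bounded A, ∫ β, β.1 a ∂κ = L (e ^ 2 * a)) ∧
      ν.map (fun β a => β.1 a) =
        (κ.withDensity fun β => ((β.1 d ^ 2).toNNReal : ENNReal)).map (fun β a => β.1 a) := by
  obtain ⟨κ, -, hκ, h⟩ := exists_boundedChars_measure (L := L) (e ^ 2)
    fun s hs => hL _ ((isSumSq_sq e).mul hs)
  have hf : Continuous fun β : BoundedChars A => β.1 d ^ 2 := (continuous_eval_subtype d).pow 2
  have := isFiniteMeasure_withDensity_continuous κ hf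
  refine ⟨κ, hκ, h, boundedChars_map_eq fun a => ?_⟩
  rw [integral_withDensity_eq_integral_smul hf.measurable.real_toNNReal, hν]
  have e1 : (a : A) = e ^ 2 * ((d ^ 2 * a : bounded A) : A) := by
    rw [MulMemClass.coe_mul, SubmonoidClass.coe_pow]
    linear_combination (-(d * e : A) - 1) * (a : A) * hde
  rw [e1, ← h]
  refine integral_congr_ae (.of_forall fun β => ?_)
  change β.1 (d ^ 2 * a) = ((β.1 d ^ 2).toNNReal : ℝ) * β.1 a
  rw [Real.coe_toNNReal _ (sq_nonneg _), map_mul, map_pow]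

/-- The density `d ^ 2` of `ν` with respect to `κ` vanishes where `d` does. -/
theorem ae_ne_zero (hL : ∀ s, IsSumSq s → 0 ≤ L s)
    (hν : ∀ a : bounded A, ∫ β, β.1 a ∂ν = L a) {d : bounded A} {e : A} (hde : (d : A) * e = 1) :
    ∀ᵐ β ∂ν, β.1 d ≠ 0 := by
  obtain ⟨κ, -, -, h⟩ := exists_map_eq_withDensity hL hν hde
  have hs : MeasurableSet {f : bounded A → ℝ | f d = 0} :=
    measurableSet_eq_fun (measurable_pi_apply d) measurable_const
  have := congrFun (congrArg DFunLike.coe h) {f | f d = 0}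
  rw [Measure.map_apply measurable_boundedChars hs, Measure.map_apply measurable_boundedChars hs]
    at this
  rw [ae_iff]
  simp only [not_not]
  refine this.trans ?_
  have hm : Measurable fun β : BoundedChars A => ((β.1 d ^ 2).toNNReal : ENNReal) :=
    ((continuous_eval_subtype d).pow 2).measurable.real_toNNReal.coe_nnreal_ennreal
  rw [withDensity_apply_eq_zero hm]
  convert measure_empty (μ := κ)
  ext β
  simp only [mem_inter_iff, mem_ofPred_eq, mem_preimage, mem_empty_iff_false, iff_false, not_and]
  intro h1 h2
  simp [h2] at h1

/-- `∫ c / d ∂ν = ∫ d ^ 2 * (c / d) ∂κ = ∫ d * c ∂κ = L (e ^ 2 * (d * c)) = L (e * c)`. -/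
theorem integral_div (hL : ∀ s, IsSumSq s → 0 ≤ L s)
    (hν : ∀ a : bounded A, ∫ β, β.1 a ∂ν = L a) {d : bounded A} {e : A} (hde : (d : A) * e = 1)
    (c : bounded A) :
    Integrable (fun β => β.1 c / β.1 d) ν ∧ ∫ β, β.1 c / β.1 d ∂ν = L (e * c) := by
  obtain ⟨κ, _, hκ, h⟩ := exists_map_eq_withDensity hL hν hde
  have hf : Measurable fun f : bounded A → ℝ => f c / f d :=
    (measurable_pi_apply c).div (measurable_pi_apply d)
  have hd : Measurable fun β : BoundedChars A => (β.1 d ^ 2).toNNReal :=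
    ((continuous_eval_subtype d).pow 2).measurable.real_toNNReal
  have e1 : ∀ β : BoundedChars A, (β.1 d ^ 2).toNNReal • (β.1 c / β.1 d) = β.1 (d * c) := by
    intro β
    change ((β.1 d ^ 2).toNNReal : ℝ) * _ = _
    rw [Real.coe_toNNReal _ (sq_nonneg _), map_mul]
    by_cases h0 : β.1 d = 0
    -- Where `d` vanishes, division by zero is harmless: both sides are zero.
    · simp [h0]
    · field_simp
  constructor
  · have : Integrable (fun f : bounded A → ℝ => f c / f d) (ν.map fun β a => β.1 a) := by
      rw [h, integrable_map_measure hf.aestronglyMeasurable measurable_boundedChars.aemeasurable]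
      refine (integrable_withDensity_iff_integrable_smul hd).2 ?_
      simp only [Function.comp_apply, e1]
      exact integrable_of_continuous (continuous_eval_subtype _)
    exact (integrable_map_measure hf.aestronglyMeasurable
      measurable_boundedChars.aemeasurable).1 this
  · have h1 := integral_map (μ := ν) measurable_boundedChars.aemeasurable
      (f := fun f : bounded A → ℝ => f c / f d) hf.aestronglyMeasurable
    rw [h, integral_map measurable_boundedChars.aemeasurable hf.aestronglyMeasurable,
      integral_withDensity_eq_integral_smul hd] at h1
    rw [← h1]
    simp only [e1]
    rw [hκ, MulMemClass.coe_mul]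
    congr 1
    linear_combination (e * c : A) * hde

/-- The measure representing `L` is concentrated on `{c ≥ 0}` if `L` is nonnegative on `c` times
sums of squares. -/
theorem ae_nonneg (hν : ∀ a : bounded A, ∫ β, β.1 a ∂ν = L a) {c : bounded A}
    (hc : ∀ s, IsSumSq s → 0 ≤ L (c * s)) : ∀ᵐ β ∂ν, 0 ≤ β.1 c := by
  obtain ⟨κ, -, _, hκ⟩ := exists_boundedChars_measure (c : A) hc
  have hp : Continuous fun β : BoundedChars A => β.1 c := continuous_eval_subtype c
  have hn : Continuous fun β : BoundedChars A => -β.1 c := hp.neg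
  have := isFiniteMeasure_withDensity_continuous ν hp
  have := isFiniteMeasure_withDensity_continuous ν hn
  -- With `κ` representing `L (c * ·)`, the signed identity `κ = c ν` is written as `κ + c⁻ ν = c⁺
  -- ν` to stay among positive measures. On `{c < 0}` the right side vanishes, hence so does `c⁻ ν`.
  have h := boundedChars_map_eq
    (μ := κ + ν.withDensity fun β => ((-β.1 c).toNNReal : ENNReal))
    (ν := ν.withDensity fun β => ((β.1 c).toNNReal : ENNReal)) fun a => by
      have hi : Integrable (fun β : BoundedChars A => (-β.1 c).toNNReal • β.1 a) ν :=
        integrable_of_continuous ((continuous_real_toNNReal.comp hn).smul (continuous_eval_subtype a))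
      rw [integral_add_measure (integrable_of_continuous (continuous_eval_subtype a))
        (integrable_of_continuous (continuous_eval_subtype a)), hκ,
        integral_withDensity_eq_integral_smul hn.measurable.real_toNNReal,
        integral_withDensity_eq_integral_smul hp.measurable.real_toNNReal,
        ← MulMemClass.coe_mul, ← hν, ← integral_add
          (integrable_of_continuous (continuous_eval_subtype (c * a))) hi]
      refine integral_congr_ae (.of_forall fun β => ?_)
      change β.1 (c * a) + ((-β.1 c).toNNReal : ℝ) * β.1 a = ((β.1 c).toNNReal : ℝ) * β.1 a
      rw [map_mul, Real.coe_toNNReal', Real.coe_toNNReal']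
      rcases le_total 0 (β.1 c) with h0 | h0
      · rw [max_eq_right (by linarith), max_eq_left h0]; ring
      · rw [max_eq_left (by linarith), max_eq_right h0]; ring
  have hs : MeasurableSet {f : bounded A → ℝ | f c < 0} :=
    measurableSet_lt (measurable_pi_apply c) measurable_const
  have h := congrFun (congrArg DFunLike.coe h) {f | f c < 0}
  rw [Measure.map_apply measurable_boundedChars hs, Measure.map_apply measurable_boundedChars hs,
    Measure.add_apply] at h
  have h0 : (ν.withDensity fun β => ((β.1 c).toNNReal : ENNReal))
      ((fun (β : BoundedChars A) (a : bounded A) => β.1 a) ⁻¹' {f | f c < 0}) = 0 := by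
    rw [withDensity_apply_eq_zero hp.measurable.real_toNNReal.coe_nnreal_ennreal]
    convert measure_empty (μ := ν)
    ext β
    simp only [mem_inter_iff, mem_ofPred_eq, mem_preimage, mem_empty_iff_false, iff_false, not_and]
    intro h1 h2
    exact h1 (by simpa using h2.le)
  rw [h0, add_eq_zero, withDensity_apply_eq_zero
    hn.measurable.real_toNNReal.coe_nnreal_ennreal] at h
  rw [ae_iff]
  convert h.2 using 2
  ext β
  simp

/-! ### Transport to the cylinder σ-algebra and support conditions. -/

/-- The image, as a measure on the cylinder σ-algebra, of a measure under a map to the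
character space. -/
def cylinderMap {X : Type*} [MeasurableSpace X] (φ : X → CharSpace A) (ν : Measure X) :
    @Measure (CharSpace A) (cylinder A) :=
  @Measure.map X (CharSpace A) _ (cylinder A) φ ν

section cylinderMap

variable {X : Type*} [MeasurableSpace X] {φ : X → CharSpace A} {ν : Measure X}

theorem cylinderMap_apply (hφ : ∀ a, Measurable fun x => φ x a) {s : Set (CharSpace A)}
    (hs : MeasurableSet[cylinder A] s) : cylinderMap φ ν s = ν (φ ⁻¹' s) :=
  @Measure.map_apply X (CharSpace A) _ (cylinder A) ν φ (measurable_cylinder_iff.2 hφ) s hs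

theorem integral_cylinderMap (hφ : ∀ a, Measurable fun x => φ x a) (a : A) :
    ∫ α, α a ∂(cylinderMap φ ν) = ∫ x, φ x a ∂ν := by
  have h1 := measurable_cylinder_iff.2 hφ
  have h2 := measurable_eval_cylinder a
  unfold cylinderMap
  let _ := cylinder A
  exact integral_map h1.aemeasurable h2.aestronglyMeasurable

theorem integrable_cylinderMap (hφ : ∀ a, Measurable fun x => φ x a) (a : A) :
    Integrable (fun α : CharSpace A => α a) (cylinderMap φ ν) ↔
      Integrable (fun x => φ x a) ν := by
  have h1 := measurable_cylinder_iff.2 hφ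
  have h2 := measurable_eval_cylinder a
  unfold cylinderMap
  let _ := cylinder A
  exact integrable_map_measure h2.aestronglyMeasurable h1.aemeasurable

theorem measurableSet_cylinder_neg (a : A) : MeasurableSet[cylinder A] {α | α a < 0} :=
  measurable_eval_cylinder a measurableSet_Iio

theorem ae_cylinderMap_nonneg (hφ : ∀ a, Measurable fun x => φ x a) {a : A}
    (h : ∀ᵐ x ∂ν, 0 ≤ φ x a) : cylinderMap φ ν {α | α a < 0} = 0 := by
  rw [cylinderMap_apply hφ (measurableSet_cylinder_neg a)]
  rw [ae_iff] at h
  simp only [not_le] at h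
  exact h

end cylinderMap

theorem isRepresenting_isProbabilityMeasure {m : MeasurableSpace (CharSpace A)}
    {μ : @Measure (CharSpace A) m} {L : A →ₗ[ℝ] ℝ} {K : Set (CharSpace A)} (hL1 : L 1 = 1)
    (h : IsRepresenting μ L K) : IsProbabilityMeasure μ := by
  have h1 := h.2 1
  simp only [map_one, hL1, integrable_const_iff, one_ne_zero, false_or, integral_const,
    smul_eq_mul, mul_one] at h1
  have := h1.1
  refine ⟨?_⟩
  rw [← ENNReal.toReal_eq_one_iff]
  exact h1.2.symm

theorem QuadraticModule.isClosed_nonnegSet (Q : QuadraticModule A) : IsClosed Q.nonnegSet := by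
  have : Q.nonnegSet = ⋂ a ∈ Q.carrier, {α : CharSpace A | 0 ≤ α a} := by
    ext α; simp [QuadraticModule.nonnegSet]
  rw [this]
  exact isClosed_biInter fun a _ => isClosed_le continuous_const (continuous_eval a)

/-- `X(S)` is second countable, so by Lindelöf countably many of the open sets `{q < 0}`, `q ∈ Q ∩
S`, already cover the complement of `K_{Q ∩ S}`. -/
theorem supportedIn_res_preimage {μ : @Measure (CharSpace A) (cylinder A)} {Q : QuadraticModule A}
    (h : ∀ q ∈ Q.carrier, μ {α | α q < 0} = 0) {S : Subalgebra ℝ A} (hS : S.FG) :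
    SupportedIn μ (res S ⁻¹' (Q.inter S).nonnegSet) := by
  refine ⟨measurable_res hS (QuadraticModule.isClosed_nonnegSet _).measurableSet, ?_⟩
  have := (borel_eq_comap_of_fg (S.fg_top.2 hS)).2
  obtain ⟨T, hT, hTc, hU⟩ := TopologicalSpace.isOpen_biUnion_countable (Q.inter S).carrier
    (fun q => {β : CharSpace S | β q < 0})
    fun q _ => isOpen_lt (continuous_eval q) continuous_const
  have hsub : (res S ⁻¹' (Q.inter S).nonnegSet)ᶜ ⊆ ⋃ q ∈ T, {α | α (q : A) < 0} := by
    intro α hα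
    have : res S α ∈ ⋃ q ∈ (Q.inter S).carrier, {β : CharSpace S | β q < 0} := by
      simp only [mem_compl_iff, mem_preimage, QuadraticModule.nonnegSet, mem_ofPred_eq, not_forall,
        not_le] at hα
      obtain ⟨q, hq, h⟩ := hα
      exact mem_biUnion hq h
    rw [← hU] at this
    obtain ⟨q, hq, h⟩ := mem_iUnion₂.1 this
    exact mem_iUnion₂.2 ⟨q, hq, h⟩
  exact measure_mono_null hsub ((measure_biUnion_null_iff hTc).2 fun q hq => h q (hT hq))

theorem supportedIn_nonnegSet {μ : @Measure (CharSpace A) (cylinder A)} {Q : QuadraticModule A}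
    (h : ∀ q ∈ Q.carrier, μ {α | α q < 0} = 0) (hQ : Q.CountablyGenerated) :
    SupportedIn μ Q.nonnegSet := by
  obtain ⟨G, hG, hGQ, hmin⟩ := hQ
  have hK : Q.nonnegSetᶜ = ⋃ g ∈ G, {α : CharSpace A | α g < 0} := by
    ext α
    simp only [mem_compl_iff, mem_iUnion, mem_ofPred_eq, exists_prop]
    constructor
    · intro hα
      by_contra! hcon
      refine hα fun a ha => ?_
      -- The elements nonnegative at `α` form a quadratic module, so nonnegativity on the generators
      -- suffices.
      let Q' : QuadraticModule A :=
        { carrier := {a | 0 ≤ α a}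
          one_mem := by simp
          add_mem := fun {a b} ha hb => by
            simp only [mem_ofPred_eq, map_add] at *; exact add_nonneg ha hb
          sq_mul_mem := fun a b hb => by
            simp only [mem_ofPred_eq, map_mul, map_pow] at *
            exact mul_nonneg (sq_nonneg _) hb }
      exact hmin Q' hcon ha
    · rintro ⟨g, hg, h⟩ hα
      exact absurd (hα g (hGQ hg)) (not_le.2 h)
  constructor
  · refine MeasurableSet.of_compl ?_
    rw [hK]
    exact MeasurableSet.biUnion hG fun g _ => measurableSet_cylinder_neg g
  · rw [hK]
    exact (measure_biUnion_null_iff hG).2 fun g hg => h g (hGQ hg)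

/-! ### Existence and uniqueness of the cylinder measure. -/

section LocPoly

variable {Ω : Type*}

theorem measurable_extendChar (b : LocPoly Ω) :
    Measurable fun β : CharSpace (bounded (LocPoly Ω)) => extendChar β b := by
  have hx : ∀ i : Ω, Measurable fun β : CharSpace (bounded (LocPoly Ω)) =>
      extendChar β (coord i) := fun i => by
    simp only [extendChar, pointChar_coord]
    exact (continuous_eval _).measurable.div (continuous_eval _).measurable
  induction b using locPoly_induction with
  | hc c => simp only [apply_algebraMap]; exact measurable_const
  | ha a b h1 h2 => simp only [map_add]; exact h1.add h2
  | hm a b h1 h2 => simp only [map_mul]; exact h1.mul h2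
  | hx i => exact hx i
  | hy i =>
    have : (fun β : CharSpace (bounded (LocPoly Ω)) => extendChar β (recip i)) =
        fun β => (1 + extendChar β (coord i) ^ 2)⁻¹ := by
      funext β
      exact eq_inv_of_mul_eq_one_left (apply_recip _ i)
    rw [this]
    exact (measurable_const.add ((hx i).pow_const 2)).inv

theorem apply_eq_div (α : CharSpace (LocPoly Ω)) {d c : bounded (LocPoly Ω)} {b e : LocPoly Ω}
    (hde : (d : LocPoly Ω) * e = 1) (hc : (c : LocPoly Ω) = d * b) :
    α (d : LocPoly Ω) ≠ 0 ∧ α b = α (c : LocPoly Ω) / α (d : LocPoly Ω) := by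
  have h := congrArg α hde
  rw [map_mul, map_one] at h
  have h0 := left_ne_zero_of_mul_eq_one h
  refine ⟨h0, ?_⟩
  rw [hc, map_mul, mul_div_cancel_left₀ _ h0]

theorem cylinder_le_comap_bounded : cylinder (LocPoly Ω) ≤ MeasurableSpace.comap
    (fun α (a : bounded (LocPoly Ω)) => α (a : LocPoly Ω)) MeasurableSpace.pi := by
  rw [cylinder_eq_comap]
  refine Measurable.comap_le (@measurable_pi_lambda _ _ _ (_) _ _ fun b => ?_)
  obtain ⟨d, c, e, hde, hc, -⟩ := exists_denominator b
  simp only [fun α : CharSpace (LocPoly Ω) => (apply_eq_div α hde hc).2]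
  have hm := fun a : bounded (LocPoly Ω) => (measurable_pi_apply a).comp
    (comap_measurable (fun (α : CharSpace (LocPoly Ω)) (a : bounded (LocPoly Ω)) =>
      α (a : LocPoly Ω)))
  exact (hm c).div (hm d)

/-- A functional on `LocPoly Ω` has at most one representing measure on the cylinder
σ-algebra. -/
theorem cylinder_ext {L : LocPoly Ω →ₗ[ℝ] ℝ} (hL1 : L 1 = 1)
    {μ μ' : @Measure (CharSpace (LocPoly Ω)) (cylinder (LocPoly Ω))}
    (hμ : IsRepresenting μ L univ) (hμ' : IsRepresenting μ' L univ) : μ = μ' := by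
  have := isRepresenting_isProbabilityMeasure hL1 hμ
  have := isRepresenting_isProbabilityMeasure hL1 hμ'
  have h := map_eq_of_integral_eq_of_bounded (μ := μ) (ν := μ')
    (AlgHom.pi (fun α : CharSpace (LocPoly Ω) => AlgHom.comp α (bounded (LocPoly Ω)).val))
    (fun a => measurable_eval_cylinder (a : LocPoly Ω))
    (fun a => (exists_abs_le a).imp fun _ h α => h _ (res_mem_nonnegSet α))
    (fun a => (hμ.2 a).2.symm.trans (hμ'.2 a).2)
  have hE : Measurable[cylinder (LocPoly Ω)] fun (α : CharSpace (LocPoly Ω))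
      (a : bounded (LocPoly Ω)) => α (a : LocPoly Ω) :=
    @measurable_pi_lambda _ _ _ (_) _ _ fun a => measurable_eval_cylinder (a : LocPoly Ω)
  refine @Measure.ext _ (cylinder _) _ _ fun s hs => ?_
  obtain ⟨t, ht, rfl⟩ := cylinder_le_comap_bounded s hs
  have h := congrFun (congrArg DFunLike.coe h) t
  exact ((@Measure.map_apply _ _ (cylinder _) _ μ _ hE t ht).symm.trans h).trans
    (@Measure.map_apply _ _ (cylinder _) _ μ' _ hE t ht)

variable {L : LocPoly Ω →ₗ[ℝ] ℝ} {ν : Measure (BoundedChars (LocPoly Ω))} [IsFiniteMeasure ν]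

/-- The exceptional null set depends on `b`, so this can be used for only countably many `b` at
once. -/
theorem ae_extendChar_eq_div (hL : ∀ s, IsSumSq s → 0 ≤ L s)
    (hν : ∀ a : bounded (LocPoly Ω), ∫ β, β.1 a ∂ν = L a) (b : LocPoly Ω) :
    ∃ (d c : bounded (LocPoly Ω)) (e : LocPoly Ω),
      (d : LocPoly Ω) * e = 1 ∧ (c : LocPoly Ω) = d * b ∧
      ∀ᵐ β ∂ν, β.1 d ≠ 0 ∧ extendChar β.1 b = β.1 c / β.1 d := by
  obtain ⟨d, c, e, hde, hc, h⟩ := exists_denominator b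
  refine ⟨d, c, e, hde, hc, ?_⟩
  filter_upwards [ae_ne_zero hL hν hde] with β hβ
  exact ⟨hβ, eq_div_of_mul_eq hβ (h _ hβ)⟩

theorem ae_extendChar_eq (hL : ∀ s, IsSumSq s → 0 ≤ L s)
    (hν : ∀ a : bounded (LocPoly Ω), ∫ β, β.1 a ∂ν = L a) (a : bounded (LocPoly Ω)) :
    ∀ᵐ β ∂ν, extendChar β.1 a = β.1 a := by
  obtain ⟨d, c, e, hde, hc, h⟩ := ae_extendChar_eq_div hL hν (a : LocPoly Ω)
  filter_upwards [h] with β hβ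
  have : c = d * a := Subtype.ext hc
  rw [hβ.2, this, map_mul, mul_div_cancel_left₀ _ hβ.1]

theorem isRepresenting_cylinderMap (hL : ∀ s, IsSumSq s → 0 ≤ L s)
    (hν : ∀ a : bounded (LocPoly Ω), ∫ β, β.1 a ∂ν = L a) :
    IsRepresenting (cylinderMap (fun β : BoundedChars (LocPoly Ω) => extendChar β.1) ν) L univ := by
  have hm : ∀ b, Measurable fun β : BoundedChars (LocPoly Ω) => extendChar β.1 b :=
    fun b => (measurable_extendChar b).comp measurable_subtype_coe
  refine ⟨⟨MeasurableSet.univ, by simp⟩, fun b => ?_⟩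
  obtain ⟨d, c, e, hde, hc, h⟩ := ae_extendChar_eq_div hL hν b
  have h' : (fun β : BoundedChars (LocPoly Ω) => extendChar β.1 b) =ᵐ[ν]
      fun β => β.1 c / β.1 d := h.mono fun β hβ => hβ.2
  rw [integrable_cylinderMap hm, integral_cylinderMap hm, integrable_congr h',
    integral_congr_ae h']
  obtain ⟨h1, h2⟩ := integral_div hL hν hde c
  refine ⟨h1, ?_⟩
  rw [h2, hc]
  congr 1
  linear_combination (-b) * hde

theorem cylinderMap_neg_eq_zero (hν : ∀ a : bounded (LocPoly Ω), ∫ β, β.1 a ∂ν = L a)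
    {Q : QuadraticModule (LocPoly Ω)} (hLQ : ∀ q ∈ Q.carrier, 0 ≤ L q)
    (hL : ∀ s, IsSumSq s → 0 ≤ L s) {q : LocPoly Ω} (hq : q ∈ Q.carrier) :
    cylinderMap (fun β : BoundedChars (LocPoly Ω) => extendChar β.1) ν {α | α q < 0} = 0 := by
  refine ae_cylinderMap_nonneg (φ := fun β : BoundedChars (LocPoly Ω) => extendChar β.1)
    (fun b => (measurable_extendChar b).comp measurable_subtype_coe) ?_
  obtain ⟨d, c, e, hde, hc, h⟩ := ae_extendChar_eq_div hL hν q
  -- The quotient `q = c / d` has the sign of `d * c = d ^ 2 * q`, which stays in `Q` after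
  -- multiplication by sums of squares.
  have hdc : ∀ s, IsSumSq s → 0 ≤ L ((d * c : bounded (LocPoly Ω)) * s) := fun s hs => by
    have : ((d * c : bounded (LocPoly Ω)) : LocPoly Ω) * s = (s * (d : LocPoly Ω) ^ 2) * q := by
      rw [MulMemClass.coe_mul, hc]; ring
    rw [this]
    exact hLQ _ (Q.isSumSq_mul_mem (hs.mul (isSumSq_sq _)) hq)
  filter_upwards [h, ae_nonneg hν hdc] with β h1 h2
  rw [h1.2]
  rw [map_mul] at h2
  have h3 : β.1 c / β.1 d = (β.1 d * β.1 c) / β.1 d ^ 2 := by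
    have := h1.1
    field_simp
  rw [h3]
  exact div_nonneg h2 (sq_nonneg _)

end LocPoly

/-! ### Radon measures compared with cylinder measures. -/

theorem cylinderMap_id_apply {ν : Measure (CharSpace A)} {s : Set (CharSpace A)}
    (hs : MeasurableSet[cylinder A] s) : cylinderMap id ν s = ν s :=
  cylinderMap_apply (φ := id) (fun a => (continuous_eval a).measurable) hs

theorem IsRepresenting.cylinderMap_id {ν : Measure (CharSpace A)} {L : A →ₗ[ℝ] ℝ}
    {K : Set (CharSpace A)} (h : IsRepresenting ν L K) :
    IsRepresenting (cylinderMap id ν) L univ := by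
  have hm : ∀ a, Measurable fun α : CharSpace A => id α a :=
    fun a => (continuous_eval a).measurable
  refine ⟨⟨MeasurableSet.univ, by simp⟩, fun a => ?_⟩
  rw [integrable_cylinderMap hm, integral_cylinderMap hm]
  exact h.2 a

/-- Basic open sets involve finitely many evaluations, hence are cylinder sets, and finitely many of
them cover `C`. -/
theorem exists_cylinder_isOpen_between {C U : Set (CharSpace A)} (hC : IsCompact C)
    (hU : IsOpen U) (hCU : C ⊆ U) :
    ∃ V, IsOpen V ∧ MeasurableSet[cylinder A] V ∧ C ⊆ V ∧ V ⊆ U := by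
  refine hC.induction_on (p := fun C => ∃ V, IsOpen V ∧ MeasurableSet[cylinder A] V ∧ C ⊆ V ∧
    V ⊆ U) ⟨∅, isOpen_empty, @MeasurableSet.empty _ (cylinder A), subset_rfl, empty_subset _⟩
    (fun s t hst ⟨V, h1, h2, h3, h4⟩ => ⟨V, h1, h2, hst.trans h3, h4⟩)
    (fun s t ⟨V, h1, h2, h3, h4⟩ ⟨V', h1', h2', h3', h4'⟩ => ⟨V ∪ V', h1.union h1',
      @MeasurableSet.union _ (cylinder A) _ _ h2 h2', union_subset_union h3 h3', union_subset h4 h4'⟩) ?_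
  intro α hα
  obtain ⟨W, hW, rfl⟩ := isEmbedding_coe.isInducing.isOpen_iff.1 hU
  obtain ⟨I, u, hu, huW⟩ := isOpen_pi_iff.1 hW _ (hCU hα)
  have ho : IsOpen (⋂ i ∈ I, {α : CharSpace A | α i ∈ u i}) :=
    isOpen_biInter_finset fun i hi => (hu i hi).1.preimage (continuous_eval i)
  refine ⟨⋂ i ∈ I, {α : CharSpace A | α i ∈ u i}, mem_nhdsWithin_of_mem_nhds (ho.mem_nhds ?_),
    _, ho, ?_, subset_rfl, ?_⟩
  · exact mem_iInter₂.2 fun i hi => (hu i hi).2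
  · exact Finset.measurableSet_biInter _ fun i hi =>
      measurable_eval_cylinder i (hu i hi).1.measurableSet
  · exact fun α' h => huW fun i hi => mem_iInter₂.1 h i hi

/-- A finite Radon measure on the character space is determined by its restriction to the
cylinder σ-algebra. -/
theorem radon_ext {ν ν' : Measure (CharSpace A)} [IsFiniteMeasure ν] [IsFiniteMeasure ν']
    [ν.InnerRegular] [ν'.InnerRegular] (h : ∀ s, MeasurableSet[cylinder A] s → ν s = ν' s) :
    ν = ν' := by
  have key : ∀ (κ κ' : Measure (CharSpace A)) [κ.InnerRegular],
      (∀ s, MeasurableSet[cylinder A] s → κ s = κ' s) → ∀ U, IsOpen U → κ U ≤ κ' U := by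
    intro κ κ' _ h U hU
    refine le_of_forall_lt fun r hr => ?_
    obtain ⟨C, hCU, hC, hr⟩ := hU.measurableSet.exists_lt_isCompact hr
    obtain ⟨V, -, hV, hCV, hVU⟩ := exists_cylinder_isOpen_between hC hU hCU
    exact hr.trans_le ((measure_mono hCV).trans ((h V hV).le.trans (measure_mono hVU)))
  refine ext_of_generate_finite _ BorelSpace.measurable_eq isPiSystem_isOpen
    (fun U hU => ?_) (h _ MeasurableSet.univ)
  exact le_antisymm (key _ _ h U hU) (key _ _ (fun s hs => (h s hs).symm) U hU)

/-- The complement is a possibly uncountable union of null open sets, but a compact set inside it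
meets only finitely many in a cover, hence is null; inner regularity concludes. -/
theorem QuadraticModule.supportedIn_of_innerRegular {ν : Measure (CharSpace A)} [ν.InnerRegular]
    {Q : QuadraticModule A} (h : ∀ q ∈ Q.carrier, ν {α | α q < 0} = 0) :
    SupportedIn ν Q.nonnegSet := by
  refine ⟨Q.isClosed_nonnegSet.measurableSet, ?_⟩
  by_contra hne
  obtain ⟨C, hCK, hC, h0⟩ := Q.isClosed_nonnegSet.measurableSet.compl.exists_lt_isCompact
    (pos_iff_ne_zero.2 hne)
  refine h0.ne' (hC.measure_zero_of_nhdsWithin fun α hα => ?_)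
  have hα' := hCK hα
  simp only [mem_compl_iff, QuadraticModule.nonnegSet, mem_ofPred_eq, not_forall, not_le] at hα'
  obtain ⟨q, hq, hlt⟩ := hα'
  exact ⟨_, mem_nhdsWithin_of_mem_nhds
    ((isOpen_lt (continuous_eval q) continuous_const).mem_nhds hlt), h q hq⟩

theorem continuous_res (S : Subalgebra ℝ A) : Continuous (res S) :=
  isEmbedding_coe.isInducing.continuous_iff.2
    (continuous_pi fun a : S => continuous_eval (a : A))

theorem map_res_apply {μ : @Measure (CharSpace A) (cylinder A)} {S : Subalgebra ℝ A} (hS : S.FG)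
    {C : Set (CharSpace A)} (hC : IsCompact C) :
    @Measure.map _ _ (cylinder A) _ (res S) μ (res S '' C) = μ (res S ⁻¹' (res S '' C)) :=
  @Measure.map_apply _ _ (cylinder A) _ μ _ (measurable_res hS) _
    (hC.image (continuous_res S)).measurableSet

/-- A Radon probability measure satisfies Prokhorov's condition. -/
theorem prokhorov_of_innerRegular {ν : Measure (CharSpace A)} [ν.InnerRegular]
    [IsProbabilityMeasure ν] : Prokhorov fun S : {S : Subalgebra ℝ A // S.FG} =>
      @Measure.map _ _ (cylinder A) _ (res S.1) (cylinderMap id ν) := by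
  intro ε hε
  have : ENNReal.ofReal (1 - ε) < ν univ := by
    rw [measure_univ, ENNReal.ofReal_lt_one]; linarith
  obtain ⟨C, -, hC, hlt⟩ := MeasurableSet.univ.exists_lt_isCompact this
  refine ⟨C, hC, fun S => ?_⟩
  rw [map_res_apply S.2 hC, cylinderMap_id_apply (measurable_res S.2
    (hC.image (continuous_res S.1)).measurableSet)]
  exact hlt.le.trans (measure_mono (subset_preimage_image _ _))

variable (A) in
/-- Restriction of characters to the bounded elements. -/
def resBounded (α : CharSpace A) : BoundedChars A := ⟨res (bounded A) α, res_mem_nonnegSet α⟩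

theorem continuous_resBounded : Continuous (resBounded A) :=
  (continuous_res _).subtype_mk _

section ContinuousOn

variable {X Y : Type*} [TopologicalSpace X] [MeasurableSpace X] [BorelSpace X]
  [TopologicalSpace Y] [MeasurableSpace Y] [BorelSpace Y] {φ : X → Y} {ν : Measure X} {W : Set X}

theorem aemeasurable_of_continuousOn (hφ : ContinuousOn φ W) (hW : MeasurableSet W)
    (hν : ∀ᵐ x ∂ν, x ∈ W) : AEMeasurable φ ν := by
  have := hφ.aemeasurable (μ := ν) hW
  rwa [Measure.restrict_eq_self_of_ae_mem hν] at this

/-- The image of a finite regular measure under a map that is continuous on a conull measurable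
set is inner regular. -/
theorem innerRegular_map_of_continuousOn [T2Space Y] [ν.Regular] [IsFiniteMeasure ν]
    (hφ : ContinuousOn φ W) (hW : MeasurableSet W) (hν : ∀ᵐ x ∂ν, x ∈ W) :
    (ν.map φ).InnerRegular := by
  have hmeas := aemeasurable_of_continuousOn hφ hW hν
  refine ⟨fun E hE r hr => ?_⟩
  rw [Measure.map_apply_of_aemeasurable hmeas hE] at hr
  -- `φ` is measurable only almost everywhere, so the preimage is cut down to `W`, where it is a
  -- genuine measurable set and regularity applies.
  have hF : MeasurableSet (φ ⁻¹' E ∩ W) := by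
    have h1 : Measurable (W.domRestrict φ) :=
      (continuousOn_iff_continuous_domRestrict.1 hφ).measurable
    have := hW.subtype_image (h1 hE)
    convert this using 1
    ext x
    simp [and_comm, Set.domRestrict]
  have hFe : ν (φ ⁻¹' E ∩ W) = ν (φ ⁻¹' E) :=
    measure_congr (by filter_upwards [hν] with x hx; exact propext (and_iff_left hx))
  rw [← hFe] at hr
  obtain ⟨T, hTF, hT, hrT⟩ := hF.exists_lt_isCompact_of_ne_top (measure_ne_top _ _) hr
  have hT' := hT.image_of_continuousOn (hφ.mono (hTF.trans inter_subset_right))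
  refine ⟨_, image_subset_iff.2 (hTF.trans inter_subset_left), hT', ?_⟩
  rw [Measure.map_apply_of_aemeasurable hmeas hT'.measurableSet]
  exact hrT.trans_le (measure_mono (subset_preimage_image _ _))

end ContinuousOn

/-! ### From Prokhorov's condition to a Radon measure. -/

section LocPoly

variable {Ω : Type*}

/-- On restrictions of genuine characters no denominator vanishes, so evaluation at `b` is the
continuous quotient `c / d`. -/
theorem continuousOn_extendChar :
    ContinuousOn (fun β : BoundedChars (LocPoly Ω) => extendChar β.1)
      (range (resBounded (LocPoly Ω))) := by
  rw [isEmbedding_coe.isInducing.continuousOn_iff]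
  refine continuousOn_pi.2 fun b => ?_
  obtain ⟨d, c, e, hde, hc, -⟩ := exists_denominator b
  have h0 : ∀ β ∈ range (resBounded (LocPoly Ω)), β.1 d ≠ 0 := by
    rintro _ ⟨α, rfl⟩
    exact (apply_eq_div α hde hc).1
  refine ContinuousOn.congr ((continuous_eval_subtype c).continuousOn.div
    (continuous_eval_subtype d).continuousOn h0) ?_
  rintro _ ⟨α, rfl⟩
  change extendChar (res (bounded _) α) b = _
  rw [extendChar_res]
  exact (apply_eq_div α hde hc).2

variable {L : LocPoly Ω →ₗ[ℝ] ℝ} {ν : Measure (BoundedChars (LocPoly Ω))} [IsFiniteMeasure ν]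

theorem le_measure_image_resBounded [ν.Regular] (hL : ∀ s, IsSumSq s → 0 ≤ L s)
    (hν : ∀ a : bounded (LocPoly Ω), ∫ β, β.1 a ∂ν = L a) {C : Set (CharSpace (LocPoly Ω))}
    (hC : IsCompact C) {r : ENNReal} (h : ∀ S : {S : Subalgebra ℝ (LocPoly Ω) // S.FG},
      r ≤ @Measure.map _ _ (cylinder (LocPoly Ω)) _ (res S.1) (cylinderMap
        (fun β : BoundedChars (LocPoly Ω) => extendChar β.1) ν) (res S.1 '' C)) :
    r ≤ ν (resBounded (LocPoly Ω) '' C) := by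
  rw [Set.measure_eq_iInf_isOpen]
  refine le_iInf₂ fun U hU => le_iInf fun hUo => ?_
  -- No `β ∉ U` agrees with an `α ∈ C` on all bounded elements. By compactness of `Uᶜ × C`, finitely
  -- many bounded elements witness this, and the subalgebra they generate is the `S` to which the
  -- hypothesis is applied.
  obtain ⟨u, hu⟩ := (hUo.isClosed_compl.isCompact.prod hC).elim_finite_subfamily_closed
    (fun a : bounded (LocPoly Ω) => {p | p.1.1 a = p.2 (a : LocPoly Ω)})
    (fun a => isClosed_eq ((continuous_eval_subtype a).comp continuous_fst)
      ((continuous_eval _).comp continuous_snd)) (by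
      rw [eq_empty_iff_forall_notMem]
      rintro ⟨β, α⟩ ⟨⟨hβ, hα⟩, h⟩
      refine hβ (hU ⟨α, hα, Subtype.ext (DFunLike.ext _ _ fun a => ?_)⟩)
      exact (mem_iInter.1 h a).symm)
  let S : Subalgebra ℝ (LocPoly Ω) := Algebra.adjoin ℝ (Subtype.val '' (u : Set (bounded (LocPoly Ω))))
  have hS : S.FG := by
    classical
    exact ⟨u.image Subtype.val, by rw [Finset.coe_image]⟩
  have hm : ∀ b, Measurable fun β : BoundedChars (LocPoly Ω) => extendChar β.1 b :=
    fun b => (measurable_extendChar b).comp measurable_subtype_coe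
  refine (h ⟨S, hS⟩).trans ?_
  rw [map_res_apply hS hC, cylinderMap_apply hm (measurable_res hS
    (hC.image (continuous_res S)).measurableSet)]
  refine measure_mono_ae ?_
  have hae : ∀ᵐ β ∂ν, ∀ a ∈ u, extendChar β.1 a = β.1 a :=
    (ae_ball_iff u.countable_toSet).2 fun a _ => ae_extendChar_eq hL hν a
  filter_upwards [hae] with β hβ
  rintro ⟨α, hα, hαβ⟩
  by_contra hβU
  have : (β, α) ∈ (∅ : Set (BoundedChars (LocPoly Ω) × CharSpace (LocPoly Ω))) := by
    rw [← hu]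
    refine ⟨⟨hβU, hα⟩, mem_iInter₂.2 fun a ha => ?_⟩
    have h1 := DFunLike.congr_fun hαβ
      (⟨a, Algebra.subset_adjoin ⟨a, ha, rfl⟩⟩ : S)
    exact (hβ a ha).symm.trans h1.symm
  exact this

/-- Under Prokhorov's condition almost every character of the bounded elements is the restriction
of a character of the whole algebra. -/
theorem exists_measurableSet_ae_mem [ν.Regular] [IsProbabilityMeasure ν]
    (hL : ∀ s, IsSumSq s → 0 ≤ L s)
    (hν : ∀ a : bounded (LocPoly Ω), ∫ β, β.1 a ∂ν = L a)
    (h : Prokhorov fun S : {S : Subalgebra ℝ (LocPoly Ω) // S.FG} =>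
      @Measure.map _ _ (cylinder (LocPoly Ω)) _ (res S.1) (cylinderMap
        (fun β : BoundedChars (LocPoly Ω) => extendChar β.1) ν)) :
    ∃ W, MeasurableSet W ∧ W ⊆ range (resBounded (LocPoly Ω)) ∧ ∀ᵐ β ∂ν, β ∈ W := by
  choose C hC hCle using fun n : ℕ => h (1 / ((n : ℝ) + 1)) (by positivity)
  have hle : ∀ n : ℕ, ENNReal.ofReal (1 - 1 / ((n : ℝ) + 1)) ≤ ν (resBounded _ '' C n) :=
    fun n => le_measure_image_resBounded hL hν (hC n) (hCle n)
  have hW : MeasurableSet (⋃ n, resBounded (LocPoly Ω) '' C n) :=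
    MeasurableSet.iUnion fun n => ((hC n).image continuous_resBounded).measurableSet
  refine ⟨⋃ n, resBounded (LocPoly Ω) '' C n, hW,
    iUnion_subset fun n => image_subset_range _ _,
    (mem_ae_iff_prob_eq_one hW).2 (le_antisymm prob_le_one ?_)⟩
  have hlim : Filter.Tendsto (fun n : ℕ => ENNReal.ofReal (1 - 1 / ((n : ℝ) + 1)))
      Filter.atTop (𝓝 (ENNReal.ofReal (1 - 0))) :=
    ENNReal.tendsto_ofReal (tendsto_one_div_add_atTop_nhds_zero_nat.const_sub 1)
  rw [sub_zero, ENNReal.ofReal_one] at hlim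
  exact le_of_tendsto' hlim fun n => (hle n).trans
    (measure_mono (subset_iUnion (fun n => resBounded (LocPoly Ω) '' C n) n))

/-- Under Prokhorov's condition the cylinder measure extends to a Radon measure. -/
theorem exists_innerRegular [ν.Regular] [IsProbabilityMeasure ν]
    (hL : ∀ s, IsSumSq s → 0 ≤ L s)
    (hν : ∀ a : bounded (LocPoly Ω), ∫ β, β.1 a ∂ν = L a)
    (h : Prokhorov fun S : {S : Subalgebra ℝ (LocPoly Ω) // S.FG} =>
      @Measure.map _ _ (cylinder (LocPoly Ω)) _ (res S.1) (cylinderMap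
        (fun β : BoundedChars (LocPoly Ω) => extendChar β.1) ν)) :
    ∃ κ : Measure (CharSpace (LocPoly Ω)), IsProbabilityMeasure κ ∧ κ.InnerRegular ∧
      ∀ s, MeasurableSet[cylinder (LocPoly Ω)] s → κ s = cylinderMap
        (fun β : BoundedChars (LocPoly Ω) => extendChar β.1) ν s := by
  obtain ⟨W, hW, hWr, hWae⟩ := exists_measurableSet_ae_mem hL hν h
  have hcont := continuousOn_extendChar.mono hWr
  have hmeas := aemeasurable_of_continuousOn hcont hW hWae
  refine ⟨_, Measure.isProbabilityMeasure_map hmeas,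
    innerRegular_map_of_continuousOn hcont hW hWae, fun s hs => ?_⟩
  rw [Measure.map_apply_of_aemeasurable hmeas (cylinder_le_borel s hs),
    cylinderMap_apply (fun b => (measurable_extendChar b).comp measurable_subtype_coe) hs]

end LocPoly

end CharMoment

end

theorem mainTheorem11 {Ω : Type*}
    (L : CharMoment.LocPoly Ω →ₗ[ℝ] ℝ) (hL1 : L 1 = 1)
    (Q : CharMoment.QuadraticModule (CharMoment.LocPoly Ω))
    (hLQ : ∀ q ∈ Q.carrier, 0 ≤ L q) :
    ∃ μ : @MeasureTheory.Measure (CharMoment.CharSpace (CharMoment.LocPoly Ω))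
        (CharMoment.cylinder (CharMoment.LocPoly Ω)),
      (CharMoment.IsCylinderSolution L Q μ ∧
        ∀ μ', CharMoment.IsCylinderSolution L Q μ' → μ' = μ) ∧
      (Q.CountablyGenerated → CharMoment.IsRepresenting μ L Q.nonnegSet) ∧
      ((∃! ν : MeasureTheory.Measure (CharMoment.CharSpace (CharMoment.LocPoly Ω)),
          CharMoment.IsRadon ν ∧ CharMoment.IsRepresenting ν L Q.nonnegSet) ↔
        CharMoment.Prokhorov fun S =>
          @MeasureTheory.Measure.map _ _ (CharMoment.cylinder (CharMoment.LocPoly Ω)) _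
            (CharMoment.res S.1) μ) := by
  open CharMoment MeasureTheory in
  have hL : ∀ s, IsSumSq s → 0 ≤ L s := fun s hs =>
    hLQ s (by simpa using Q.isSumSq_mul_mem hs Q.one_mem)
  obtain ⟨ν, _, _, hν⟩ := exists_boundedChars_measure (L := L) 1 (by simpa using hL)
  simp only [one_mul] at hν
  have hrep := isRepresenting_cylinderMap hL hν
  have hneg := fun q (hq : q ∈ Q.carrier) => cylinderMap_neg_eq_zero hν hLQ hL hq
  refine ⟨_, ⟨⟨hrep, fun S hS => supportedIn_res_preimage hneg hS⟩,
    fun μ' h => cylinder_ext hL1 h.1 hrep⟩, fun hQ => ⟨supportedIn_nonnegSet hneg hQ, hrep.2⟩,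
    ?_, ?_⟩
  · rintro ⟨κ, ⟨⟨_, _⟩, hκ⟩, -⟩
    have := isRepresenting_isProbabilityMeasure hL1 hκ
    -- Uniqueness identifies the restriction of the Radon measure to the cylinder σ-algebra with
    -- `μ`.
    rw [← cylinder_ext hL1 hκ.cylinderMap_id hrep]
    exact prokhorov_of_innerRegular
  · intro hP
    have : IsProbabilityMeasure ν := by
      have h1 := hν 1
      simp only [map_one, integral_const, smul_eq_mul, mul_one, OneMemClass.coe_one, hL1] at h1
      exact ⟨(ENNReal.toReal_eq_one_iff _).1 h1⟩
    obtain ⟨κ, _, _, hκ⟩ := exists_innerRegular hL hν hP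
    have hid : cylinderMap id κ = cylinderMap (fun β : BoundedChars _ => extendChar β.1) ν :=
      @Measure.ext _ (cylinder _) _ _ fun s hs => by rw [cylinderMap_id_apply hs, hκ s hs]
    have hm : ∀ a, Measurable fun α : CharSpace (LocPoly Ω) => id α a :=
      fun a => (continuous_eval a).measurable
    refine ⟨κ, ⟨⟨inferInstance, inferInstance⟩,
      QuadraticModule.supportedIn_of_innerRegular fun q hq => ?_, fun a => ?_⟩, ?_⟩
    · rw [hκ _ (measurableSet_cylinder_neg q)]
      exact hneg q hq
    · have := hrep.2 a
      rw [← hid, integrable_cylinderMap hm, integral_cylinderMap hm] at this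
      exact this
    · rintro κ' ⟨⟨_, _⟩, hκ'⟩
      have := isRepresenting_isProbabilityMeasure hL1 hκ'
      refine radon_ext fun s hs => ?_
      rw [hκ s hs, ← cylinder_ext hL1 hκ'.cylinderMap_id hrep, cylinderMap_id_apply hs]
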